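/- Let $n\ge 2$, $a\in(-1,1)$, $\nu=\frac{a-1}{2}$, and write points of $\mathbb R^n=\mathbb R^{n-1}\times\mathbb R$ as $X=(x',x)$, $Y=(y',y)$. Consider the degenerate parabolic operator $\mathscr L_a u=\partial_t(|y|^a u)-\operatorname{div}_Y(|y|^a\nabla_Y u)$. For $t>\tau$ set $$\Gamma(X,t;Y,\tau)=(4\pi(t-\tau))^{-\frac{n-1}{2}}e^{-\frac{|x'-y'|^2}{4(t-\tau)}}\,(4(t-\tau))^{-\frac{a+1}{2}}e^{-\frac{(x-y)^2}{4(t-\tau)}}e^{-\frac{xy}{2(t-\tau)}}\left(\sum_{k=0}^\infty\frac{z^{2k}}{k!\,\Gamma(k+\nu+1)}+z|z|^{-a}\sum_{k=0}^\infty\frac{z^{2k}}{k!\,\Gamma(k-\nu+1)}\right),\qquad z=\frac{xy}{4(t-\tau)},$$ where $z|z|^{-a}=0$ for $z=0$ and the one-argument $\Gamma$ is Euler's gamma function, and set $\Gamma(X,t;Y,\tau)=0$ for $t\le\tau$. Then $\Gamma$ is a fundamental solution of $\mathscr L_a$, in the following sense. (i) For all $X\in\mathbb R^n$ and $t\in\mathbb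 R$, the function $(Y,\tau)\mapsto\Gamma(X,t;Y,\tau)$ is a weak solution in $U=\mathbb R^n\times(-\infty,t)$. That is: it is differentiable at every $(Y,\tau)\in U$ with $y\neq0$; it and its pointwise gradient $\nabla_Y\Gamma$ are locally integrable in $U$, and $\nabla_Y\Gamma$ is its weak spatial gradient in $U$; the functions $|y|^a\Gamma^2$ and $|y|^a|\nabla_Y\Gamma|^2$ are integrable on every compact subset of $U$; and for every $C^1$ function $\varphi$ with compact support in $U$, $$\int_{-\infty}^t\int_{\mathbb R^n}|y|^a\left(\Gamma\,\partial_\tau\varphi+\nabla_Y\Gamma\cdot\nabla_Y\varphi\right)dY\,d\tau=0,$$ the integrand being integrable on $U$. (ii) For every bounded continuous $g:\mathbb R^n\to\mathbb R$, every $X\in\mathbb R^n$ and every $\tau\in\mathbb R$, the function $Y\mapsto\Gamma(X,t;Y,\tau)g(Y)|y|^a$ is integrable on $\mathbb R^n$ for each $t>\tau$, and $$\lim_{t\to\tau^+}\int_{\mathbb R^n}\Gamma(X,t;Y,\tau)\,g(Y)\,|y|^a\,dY=g(X).$$ -/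

import Mathlib

open MeasureTheory Set Filter Topology

namespace DegenerateHeat

noncomputable section

/-- Points `Y = (y', y)` of `ℝⁿ = ℝⁿ⁻¹ × ℝ`. The factor `ℝⁿ⁻¹` carries the Euclidean norm; the
measure on the product is Lebesgue measure, and its topology is the usual one. -/
abbrev Space (n : ℕ) : Type := EuclideanSpace ℝ (Fin (n - 1)) × ℝ

/-- The Euclidean inner product on `ℝⁿ = ℝⁿ⁻¹ × ℝ`. -/
def dot {n : ℕ} (V W : Space n) : ℝ := inner ℝ V.1 W.1 + V.2 * W.2

/-- `∑ₖ z^(2k) / (k! Γ(k + μ + 1))`, which is `z^(-μ) I_μ(2z)` for `z > 0`, with `I_μ` the modified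
Bessel function of the first kind. -/
def besselSeries (μ z : ℝ) : ℝ :=
  ∑' k : ℕ, z ^ (2 * k) / ((k.factorial : ℝ) * Real.Gamma ((k : ℝ) + μ + 1))

/-- The factor of the kernel in the degenerate variable, at elapsed time `s > 0`. -/
def kernel1 (a x y s : ℝ) : ℝ :=
  (4 * s) ^ (-(a + 1) / 2) * Real.exp (-(x - y) ^ 2 / (4 * s)) * Real.exp (-(x * y) / (2 * s)) *
    (besselSeries ((a - 1) / 2) (x * y / (4 * s)) +
      x * y / (4 * s) * (|x * y| / (4 * s)) ^ (-a) *
        besselSeries (-((a - 1) / 2)) (x * y / (4 * s)))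

/-- The kernel `Γ(X, t; Y, τ)` of the operator `u ↦ |y|^a ∂ₜu - div(|y|^a ∇u)`. -/
def Γ (n : ℕ) (a : ℝ) (X : Space n) (t : ℝ) (Y : Space n) (τ : ℝ) : ℝ :=
  if τ < t then
    (4 * Real.pi * (t - τ)) ^ (-((n : ℝ) - 1) / 2) *
      Real.exp (-‖X.1 - Y.1‖ ^ 2 / (4 * (t - τ))) * kernel1 a X.2 Y.2 (t - τ)
  else 0

/-- The pointwise spatial gradient `∇_Y u = (∇_{y'} u, ∂_y u)` of a function of `(Y, τ)`. -/
def spatialGrad {n : ℕ} (u : Space n × ℝ → ℝ) (p : Space n × ℝ) : Space n :=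
  (gradient (fun y' => u ((y', p.1.2), p.2)) p.1.1, deriv (fun y => u ((p.1.1, y), p.2)) p.1.2)

/-- The pointwise time derivative of a function of `(Y, τ)`. -/
def timeDeriv {n : ℕ} (u : Space n × ℝ → ℝ) (p : Space n × ℝ) : ℝ :=
  deriv (fun s => u (p.1, s)) p.2

/-- `φ ∈ C₀¹(U)`: continuously differentiable with compact support contained in `U`. -/
def IsTest {n : ℕ} (U : Set (Space n × ℝ)) (φ : Space n × ℝ → ℝ) : Prop :=
  ContDiff ℝ 1 φ ∧ HasCompactSupport φ ∧ tsupport φ ⊆ U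

/-- `G` is the weak (distributional) spatial gradient of `u` in the open set `U`. -/
def IsWeakSpatialGrad {n : ℕ} (U : Set (Space n × ℝ)) (u : Space n × ℝ → ℝ)
    (G : Space n × ℝ → Space n) : Prop :=
  LocallyIntegrableOn u U ∧ LocallyIntegrableOn G U ∧
    ∀ ψ : Space n × ℝ → ℝ, IsTest U ψ →
      ∫ p in U, u p • spatialGrad ψ p = -∫ p in U, ψ p • G p

/-- `u`, with weak spatial gradient `G`, belongs locally in `U` to the weighted energy space
`L²(H¹(|y|^a))`. -/
def MemEnergyLoc {n : ℕ} (a : ℝ) (U : Set (Space n × ℝ)) (u : Space n × ℝ → ℝ)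
    (G : Space n × ℝ → Space n) : Prop :=
  IsWeakSpatialGrad U u G ∧
    ∀ K : Set (Space n × ℝ), IsCompact K → K ⊆ U →
      IntegrableOn (fun p => |p.1.2| ^ a * u p ^ 2) K ∧
      IntegrableOn (fun p => |p.1.2| ^ a * dot (G p) (G p)) K

/-- `u`, with weak spatial gradient `G`, is a weak solution in `U`, in the variables `(Y, τ)`
of the second argument of the kernel, that is, of
`|y|^a ∂_τ u + div_Y (|y|^a ∇_Y u) = 0`. -/
def IsWeakSolution {n : ℕ} (a : ℝ) (U : Set (Space n × ℝ)) (u : Space n × ℝ → ℝ)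
    (G : Space n × ℝ → Space n) : Prop :=
  MemEnergyLoc a U u G ∧
    ∀ φ : Space n × ℝ → ℝ, IsTest U φ →
      IntegrableOn (fun p => |p.1.2| ^ a * (u p * timeDeriv φ p + dot (G p) (spatialGrad φ p))) U ∧
      ∫ p in U, |p.1.2| ^ a * (u p * timeDeriv φ p + dot (G p) (spatialGrad φ p)) = 0

end

end DegenerateHeat

open DegenerateHeat

/-! ### Bessel series and Gamma function estimates. -/

namespace DegenerateHeat

noncomputable section

/-! Put h(y) = y|y|^(-a) (`oddPower`), the non-constant solution of (|y|^a h')' = 0. At elapsed time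
s > 0 the degenerate factor of the kernel is E_a + h(x) h(y) E_{2-a} (`kernel1_eq`), where E_p =
`evenKernel p` is even in y, solves the heat equation of ∂_y² + (p/y)∂_y, and has mass one for |y|^p
dy (`integral_evenKernel`). The second summand is an h-transform: |y|^a h² = |y|^(2-a). Both the
equation and the moments of E_p rest on two facts about a normalised Bessel series: differentiation
raises the parameter by one, and three consecutive parameters satisfy a linear recurrence.

Weak equation. Off y = 0 the y-derivative of the kernel is a continuous function plus |y|^(-a) times
a continuous function. Since -1 < a < 1, both |y|^a and |y|^(-a) are locally integrable, which gives
the local energy bounds. The flux |y|^a ∂_y extends continuously across y = 0, and its y-derivative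
is |y|^a times the time derivative of the degenerate factor (`hasDerivAt_kernelFlux`). Integration
by parts therefore leaves no contribution on the hyperplane y = 0, and the weak equation reduces to
the pointwise one, `profile_equation`.

Initial trace. Positivity of the kernel is not used. A Gamma function estimate gives I_θ ≤ C I_{-θ},
so the full kernel is dominated by a multiple of its even part (`abs_oddPower_mul_evenKernel_le`).
The even part concentrates as s → 0 at the two points (x', ±x): the integral of |x' - y'|² + (y² -
x²)² against it tends to zero (`exists_reflDist_majorant`). Hence integrals of continuous functions
of quadratic growth that vanish at both points tend to zero. The functions α + β h(y) are reproduced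
exactly at every positive time (`integral_kernelDensity_mul_affine`), and since h is odd and nonzero
off 0 they interpolate g at the two points. Subtracting the interpolant from g leaves an integral
tending to zero and the exact value g(X). -/

/-- The entire function `w ↦ ∑ₖ w ^ k / (k! Γ(k + μ + 1))`, a normalisation of `₀F₁(; μ + 1; w)`. -/
def hypSeries (μ w : ℝ) : ℝ :=
  ∑' k : ℕ, w ^ k / ((k.factorial : ℝ) * Real.Gamma ((k : ℝ) + μ + 1))

lemma besselSeries_eq (μ z : ℝ) : besselSeries μ z = hypSeries μ (z ^ 2) := by
  simp only [besselSeries, hypSeries, pow_mul]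

lemma gamma_nat_add_pos {μ : ℝ} (hμ : -1 < μ) (k : ℕ) : 0 < Real.Gamma ((k : ℝ) + μ + 1) :=
  Real.Gamma_pos_of_pos (by have : (0 : ℝ) ≤ k := k.cast_nonneg; linarith)

/-- The first value is kept apart because μ + 1 may be less than 1. From Γ(μ + 2) on, each integer
step multiplies by a factor at least 1. -/
lemma exists_le_gamma {μ : ℝ} (hμ : -1 < μ) :
    ∃ m : ℝ, 0 < m ∧ ∀ k : ℕ, m ≤ Real.Gamma ((k : ℝ) + μ + 1) := by
  refine ⟨min (Real.Gamma (μ + 1)) (Real.Gamma (μ + 2)),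
    lt_min (Real.Gamma_pos_of_pos (by linarith)) (Real.Gamma_pos_of_pos (by linarith)), ?_⟩
  intro k
  rcases k with _ | k
  · simp
  · induction k with
    | zero =>
      refine (min_le_right _ _).trans (le_of_eq ?_)
      congr 1; push_cast; ring
    | succ k ih =>
      refine ih.trans ?_
      have h0 : (0 : ℝ) ≤ k := k.cast_nonneg
      have : Real.Gamma (((k + 1 + 1 : ℕ) : ℝ) + μ + 1) =
          (((k + 1 : ℕ) : ℝ) + μ + 1) * Real.Gamma (((k + 1 : ℕ) : ℝ) + μ + 1) := by
        rw [← Real.Gamma_add_one (by push_cast; linarith)]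
        congr 1; push_cast; ring
      rw [this]
      refine le_mul_of_one_le_left (gamma_nat_add_pos hμ (k + 1)).le ?_
      push_cast; linarith

lemma summable_hypSeries {μ : ℝ} (hμ : -1 < μ) (w : ℝ) :
    Summable fun k : ℕ => w ^ k / ((k.factorial : ℝ) * Real.Gamma ((k : ℝ) + μ + 1)) := by
  obtain ⟨m, hm, hle⟩ := exists_le_gamma hμ
  refine Summable.of_norm_bounded ((Real.summable_pow_div_factorial |w|).mul_right (1 / m)) ?_
  intro k
  have hk : (0 : ℝ) < k.factorial := by exact_mod_cast k.factorial_pos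
  rw [Real.norm_eq_abs, abs_div, abs_pow, abs_mul, abs_of_pos hk,
    abs_of_pos (gamma_nat_add_pos hμ k), div_mul_div_comm, mul_one]
  gcongr
  exact hle k

lemma hypSeries_nonneg {μ w : ℝ} (hμ : -1 < μ) (hw : 0 ≤ w) : 0 ≤ hypSeries μ w :=
  tsum_nonneg fun k => div_nonneg (pow_nonneg hw k)
    (mul_nonneg (by positivity) (gamma_nat_add_pos hμ k).le)

/-- Differentiating a term cancels k against k!, and the shift of index is absorbed by the
parameter. Domination on the ball of radius |w| + 1 justifies working termwise. -/
lemma hasDerivAt_hypSeries {μ : ℝ} (hμ : -1 < μ) (w : ℝ) :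
    HasDerivAt (hypSeries μ) (hypSeries (μ + 1) w) w := by
  have key : ∀ (r : ℝ) (k : ℕ), ((k + 1 : ℕ) : ℝ) * r ^ (k + 1 - 1) /
      (((k + 1).factorial : ℝ) * Real.Gamma (((k + 1 : ℕ) : ℝ) + μ + 1)) =
      r ^ k / ((k.factorial : ℝ) * Real.Gamma ((k : ℝ) + (μ + 1) + 1)) := by
    intro r k
    have h1 : ((k + 1 : ℕ) : ℝ) ≠ 0 := by positivity
    have h2 : ((k + 1 : ℕ) : ℝ) + μ + 1 = (k : ℝ) + (μ + 1) + 1 := by push_cast; ring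
    rw [h2, Nat.factorial_succ, Nat.cast_mul, mul_assoc, Nat.add_sub_cancel,
      mul_div_mul_left _ _ h1]
  have hsum : ∀ r : ℝ, Summable fun k : ℕ => (k : ℝ) * r ^ (k - 1) /
      ((k.factorial : ℝ) * Real.Gamma ((k : ℝ) + μ + 1)) := by
    intro r
    rw [← summable_nat_add_iff 1]
    simp only [key]
    exact summable_hypSeries (by linarith) r
  have h := hasDerivAt_tsum_of_isPreconnected (t := Metric.ball (0 : ℝ) (|w| + 1))
    (g := fun (k : ℕ) (y : ℝ) => y ^ k / ((k.factorial : ℝ) * Real.Gamma ((k : ℝ) + μ + 1)))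
    (g' := fun (k : ℕ) (y : ℝ) => (k : ℝ) * y ^ (k - 1) /
      ((k.factorial : ℝ) * Real.Gamma ((k : ℝ) + μ + 1))) (y₀ := 0) (y := w)
    (hsum (|w| + 1)) Metric.isOpen_ball (convex_ball _ _).isPreconnected
    (fun k y _ => (hasDerivAt_pow k y).div_const _)
    (fun k y hy => by
      have hy' : |y| ≤ |w| + 1 := by
        rw [Metric.mem_ball, dist_zero_right, Real.norm_eq_abs] at hy; exact hy.le
      have hk : (0 : ℝ) < k.factorial := by exact_mod_cast k.factorial_pos
      have hG := gamma_nat_add_pos hμ k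
      rw [Real.norm_eq_abs, abs_div, abs_mul, abs_pow, abs_mul, abs_of_pos hk, abs_of_pos hG,
        Nat.abs_cast]
      gcongr)
    (Metric.mem_ball_self (by positivity)) (summable_hypSeries hμ 0)
    (by rw [Metric.mem_ball, dist_zero_right, Real.norm_eq_abs]; linarith)
  have h2 : hypSeries (μ + 1) w = ∑' k : ℕ, (k : ℝ) * w ^ (k - 1) /
      ((k.factorial : ℝ) * Real.Gamma ((k : ℝ) + μ + 1)) := by
    rw [(hsum w).tsum_eq_zero_add]
    simp only [key]
    simp [hypSeries]
  rw [h2]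
  exact h

/-- Termwise this is Γ(z + 1) = z Γ(z) at z = k + μ + 1, with z split as (μ + 1) + k. Combined with
the derivative formula it is the equation w F'' + (μ + 1) F' = F. -/
lemma hypSeries_recurrence {μ : ℝ} (hμ : -1 < μ) (w : ℝ) :
    hypSeries μ w = (μ + 1) * hypSeries (μ + 1) w + w * hypSeries (μ + 2) w := by
  have key : ∀ k : ℕ, ((k + 1 : ℕ) : ℝ) * w ^ (k + 1) /
      (((k + 1).factorial : ℝ) * Real.Gamma (((k + 1 : ℕ) : ℝ) + (μ + 1) + 1)) =
      w * (w ^ k / ((k.factorial : ℝ) * Real.Gamma ((k : ℝ) + (μ + 2) + 1))) := by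
    intro k
    have h1 : ((k + 1 : ℕ) : ℝ) ≠ 0 := by positivity
    have h2 : ((k + 1 : ℕ) : ℝ) + (μ + 1) + 1 = (k : ℝ) + (μ + 2) + 1 := by push_cast; ring
    rw [h2, Nat.factorial_succ, Nat.cast_mul, mul_assoc, mul_div_mul_left _ _ h1, pow_succ]
    ring
  have hs2 : Summable fun k : ℕ => (k : ℝ) * w ^ k /
      ((k.factorial : ℝ) * Real.Gamma ((k : ℝ) + (μ + 1) + 1)) := by
    rw [← summable_nat_add_iff 1]
    simp only [key]
    exact (summable_hypSeries (by linarith) w).mul_left w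
  have h2 : w * hypSeries (μ + 2) w = ∑' k : ℕ, (k : ℝ) * w ^ k /
      ((k.factorial : ℝ) * Real.Gamma ((k : ℝ) + (μ + 1) + 1)) := by
    rw [hs2.tsum_eq_zero_add]
    simp only [key]
    simp [hypSeries, tsum_mul_left]
  have hs1 := (summable_hypSeries (μ := μ + 1) (by linarith) w).mul_left (μ + 1)
  rw [h2, hypSeries, hypSeries, ← tsum_mul_left, ← hs1.tsum_add hs2]
  refine tsum_congr fun k => ?_
  have h0 : (0 : ℝ) < (k : ℝ) + μ + 1 := by
    have : (0 : ℝ) ≤ k := k.cast_nonneg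
    linarith
  have hk : (k.factorial : ℝ) ≠ 0 := by positivity
  have hG := (gamma_nat_add_pos hμ k).ne'
  have h3 : Real.Gamma ((k : ℝ) + (μ + 1) + 1) =
      ((k : ℝ) + μ + 1) * Real.Gamma ((k : ℝ) + μ + 1) := by
    rw [← Real.Gamma_add_one h0.ne']
    congr 1; ring
  rw [h3]
  field_simp
  ring

/-- A two-sided form of Gautschi's inequality. -/
lemma gamma_sub_mul_rpow_le {θ x : ℝ} (hθ : 0 < θ) (hθ1 : θ < 1) (hx : 1 ≤ x) :
    Real.Gamma (x - θ) * x ^ (2 * θ) ≤ 2 / (1 - θ) * Real.Gamma (x + θ) := by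
  have hx0 : 0 < x := by linarith
  have hG := Real.Gamma_pos_of_pos hx0
  have hGp : 0 < Real.Gamma (x + θ) := Real.Gamma_pos_of_pos (by linarith)
  -- Log-convexity of Γ with weights θ and 1 - θ, here between x and x + 1, and in `h2` between x +
  -- θ and x + θ + 1. The comparison of Γ(x - θ) with Γ(x + θ) passes through Γ(x).
  have h1 : Real.Gamma (x + 1 - θ) ≤ Real.Gamma x * x ^ (1 - θ) := by
    have h := Real.Gamma_mul_add_mul_le_rpow_Gamma_mul_rpow_Gamma (s := x) (t := x + 1)
      (a := θ) (b := 1 - θ) hx0 (by linarith) hθ (by linarith) (by ring)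
    rw [Real.Gamma_add_one hx0.ne', Real.mul_rpow hx0.le hG.le] at h
    calc Real.Gamma (x + 1 - θ) = Real.Gamma (θ * x + (1 - θ) * (x + 1)) := by congr 1; ring
      _ ≤ _ := h
      _ = (Real.Gamma x ^ θ * Real.Gamma x ^ (1 - θ)) * x ^ (1 - θ) := by ring
      _ = Real.Gamma x * x ^ (1 - θ) := by
        rw [← Real.rpow_add hG, add_sub_cancel, Real.rpow_one]
  have h2 : Real.Gamma (x + 1) ≤ Real.Gamma (x + θ) * (x + θ) ^ (1 - θ) := by
    have h := Real.Gamma_mul_add_mul_le_rpow_Gamma_mul_rpow_Gamma (s := x + θ) (t := x + θ + 1)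
      (a := θ) (b := 1 - θ) (by linarith) (by linarith) hθ (by linarith) (by ring)
    rw [Real.Gamma_add_one (s := x + θ) (by linarith), Real.mul_rpow (by linarith) hGp.le] at h
    calc Real.Gamma (x + 1) = Real.Gamma (θ * (x + θ) + (1 - θ) * (x + θ + 1)) := by
          congr 1; ring
      _ ≤ _ := h
      _ = (Real.Gamma (x + θ) ^ θ * Real.Gamma (x + θ) ^ (1 - θ)) * (x + θ) ^ (1 - θ) := by ring
      _ = Real.Gamma (x + θ) * (x + θ) ^ (1 - θ) := by
        rw [← Real.rpow_add hGp, add_sub_cancel, Real.rpow_one]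
  have h3 : (x + θ) ^ (1 - θ) ≤ 2 * x ^ (1 - θ) := by
    calc (x + θ) ^ (1 - θ) ≤ (2 * x) ^ (1 - θ) :=
          Real.rpow_le_rpow (by linarith) (by linarith) (by linarith)
      _ = 2 ^ (1 - θ) * x ^ (1 - θ) := Real.mul_rpow (by norm_num) hx0.le
      _ ≤ 2 ^ (1 : ℝ) * x ^ (1 - θ) := by
        gcongr
        · norm_num
        · linarith
      _ = _ := by rw [Real.rpow_one]
  have hxx : x = x ^ θ * x ^ (1 - θ) := by
    rw [← Real.rpow_add hx0, add_sub_cancel, Real.rpow_one]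
  have hpθ : 0 < x ^ θ := Real.rpow_pos_of_pos hx0 _
  have hp1 : 0 < x ^ (1 - θ) := Real.rpow_pos_of_pos hx0 _
  have h4 : Real.Gamma x * x ^ θ ≤ 2 * Real.Gamma (x + θ) := by
    rw [Real.Gamma_add_one hx0.ne'] at h2
    have : (Real.Gamma x * x ^ θ) * x ^ (1 - θ) ≤ (2 * Real.Gamma (x + θ)) * x ^ (1 - θ) := by
      calc (Real.Gamma x * x ^ θ) * x ^ (1 - θ) = (x ^ θ * x ^ (1 - θ)) * Real.Gamma x := by ring
        _ = x * Real.Gamma x := by rw [← hxx]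
        _ ≤ _ := h2
        _ ≤ Real.Gamma (x + θ) * (2 * x ^ (1 - θ)) := by gcongr
        _ = _ := by ring
    exact le_of_mul_le_mul_right this hp1
  have h5 : Real.Gamma (x - θ) * ((1 - θ) * x ^ θ) ≤ Real.Gamma x := by
    have hGm : 0 < Real.Gamma (x - θ) := Real.Gamma_pos_of_pos (by linarith)
    have h6 : Real.Gamma (x + 1 - θ) = (x - θ) * Real.Gamma (x - θ) := by
      rw [← Real.Gamma_add_one (by linarith)]
      congr 1; ring
    rw [h6] at h1
    have h7 : (1 - θ) * x ≤ x - θ := by nlinarith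
    have : (Real.Gamma (x - θ) * ((1 - θ) * x ^ θ)) * x ^ (1 - θ) ≤
        Real.Gamma x * x ^ (1 - θ) := by
      calc (Real.Gamma (x - θ) * ((1 - θ) * x ^ θ)) * x ^ (1 - θ)
          = ((1 - θ) * (x ^ θ * x ^ (1 - θ))) * Real.Gamma (x - θ) := by ring
        _ = ((1 - θ) * x) * Real.Gamma (x - θ) := by rw [← hxx]
        _ ≤ (x - θ) * Real.Gamma (x - θ) := by gcongr
        _ ≤ _ := h1
    exact le_of_mul_le_mul_right this hp1
  have h2θ : x ^ (2 * θ) = x ^ θ * x ^ θ := by rw [two_mul, Real.rpow_add hx0]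
  have h1θ : 0 < 1 - θ := by linarith
  rw [h2θ, div_mul_eq_mul_div, le_div_iff₀ h1θ]
  calc Real.Gamma (x - θ) * (x ^ θ * x ^ θ) * (1 - θ)
      = (Real.Gamma (x - θ) * ((1 - θ) * x ^ θ)) * x ^ θ := by ring
    _ ≤ Real.Gamma x * x ^ θ := by gcongr
    _ ≤ _ := h4

/-- In Bessel terms, I_θ ≤ C I_{-θ} with C = 4 / (1 - θ). Each term on the left is bounded by two
consecutive terms of the series on the right, which accounts for one factor 2; the other comes from
the Gamma quotient. -/
lemma rpow_mul_hypSeries_le {θ w : ℝ} (hθ : 0 < θ) (hθ1 : θ < 1) (hw : 0 ≤ w) :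
    w ^ θ * hypSeries θ w ≤ 4 / (1 - θ) * hypSeries (-θ) w := by
  set c : ℕ → ℝ := fun k => w ^ k / ((k.factorial : ℝ) * Real.Gamma ((k : ℝ) + -θ + 1)) with hc
  have hcs : Summable c := summable_hypSeries (by linarith) w
  have hc0 : ∀ k, 0 ≤ c k := fun k => div_nonneg (pow_nonneg hw k)
    (mul_nonneg (by positivity) (gamma_nat_add_pos (by linarith) k).le)
  have h1θ : 0 < 1 - θ := by linarith
  have hterm : ∀ k : ℕ, w ^ θ * (w ^ k / ((k.factorial : ℝ) * Real.Gamma ((k : ℝ) + θ + 1))) ≤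
      2 / (1 - θ) * (c k + c (k + 1)) := by
    intro k
    have hk0 : (0 : ℝ) ≤ k := k.cast_nonneg
    have hkf : (0 : ℝ) < k.factorial := by exact_mod_cast k.factorial_pos
    set x : ℝ := (k : ℝ) + 1 with hx
    have hx1 : 1 ≤ x := by linarith
    have hx0 : 0 < x := by linarith
    have hGm : 0 < Real.Gamma (x - θ) := Real.Gamma_pos_of_pos (by linarith)
    have hGp : 0 < Real.Gamma (x + θ) := Real.Gamma_pos_of_pos (by linarith)
    have hxθ : 0 < x - θ := by linarith
    have hg := gamma_sub_mul_rpow_le hθ hθ1 hx1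
    have e1 : (k : ℝ) + θ + 1 = x + θ := by rw [hx]; ring
    have e2 : (k : ℝ) + -θ + 1 = x - θ := by rw [hx]; ring
    have ec : c (k + 1) = c k * (w / (x * (x - θ))) := by
      have e3 : ((k + 1 : ℕ) : ℝ) + -θ + 1 = (x - θ) + 1 := by rw [hx]; push_cast; ring
      simp only [hc]
      rw [e3, e2, Real.Gamma_add_one hxθ.ne', Nat.factorial_succ, Nat.cast_mul, pow_succ]
      have : ((k + 1 : ℕ) : ℝ) = x := by push_cast; rfl
      rw [this]
      field_simp
    -- This is u ^ θ ≤ 1 + u at u = w / x². Enlarging u on the right to w / (x (x - θ)), the ratio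
    -- of consecutive terms `c (k + 1) / c k`, makes the bound a multiple of `c k + c (k + 1)`.
    have hwθ : w ^ θ ≤ x ^ (2 * θ) * (1 + w / (x * (x - θ))) := by
      have hm : w / (x * x) ≤ w / (x * (x - θ)) := by gcongr; linarith
      have hq : 0 ≤ w / (x * x) := by positivity
      have h1 : (w / (x * x)) ^ θ ≤ 1 + w / (x * x) := by
        rcases le_total (w / (x * x)) 1 with h | h
        · have := Real.rpow_le_one hq h hθ.le
          linarith
        · have := Real.rpow_le_rpow_of_exponent_le h hθ1.le
          rw [Real.rpow_one] at this
          linarith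
      calc w ^ θ = ((x * x) * (w / (x * x))) ^ θ := by congr 1; field_simp
        _ = (x * x) ^ θ * (w / (x * x)) ^ θ := Real.mul_rpow (by positivity) hq
        _ = x ^ (2 * θ) * (w / (x * x)) ^ θ := by
          rw [Real.rpow_mul hx0.le, Real.rpow_two, sq]
        _ ≤ x ^ (2 * θ) * (1 + w / (x * (x - θ))) := by
          gcongr
          linarith
    have hd : x ^ (2 * θ) / Real.Gamma (x + θ) ≤ 2 / (1 - θ) / Real.Gamma (x - θ) := by
      rw [div_le_div_iff₀ hGp hGm]
      linarith
    rw [ec, e1]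
    have hpos : 0 ≤ 1 + w / (x * (x - θ)) := by positivity
    calc w ^ θ * (w ^ k / ((k.factorial : ℝ) * Real.Gamma (x + θ)))
        ≤ x ^ (2 * θ) * (1 + w / (x * (x - θ))) *
          (w ^ k / ((k.factorial : ℝ) * Real.Gamma (x + θ))) := by gcongr
      _ = x ^ (2 * θ) / Real.Gamma (x + θ) *
          ((1 + w / (x * (x - θ))) * (w ^ k / (k.factorial : ℝ))) := by
        field_simp
      _ ≤ 2 / (1 - θ) / Real.Gamma (x - θ) *
          ((1 + w / (x * (x - θ))) * (w ^ k / (k.factorial : ℝ))) := by gcongr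
      _ = 2 / (1 - θ) * (c k + c k * (w / (x * (x - θ)))) := by
        simp only [hc, e2]
        field_simp
  have hcs1 : Summable fun k => c (k + 1) := (summable_nat_add_iff 1).2 hcs
  have hle1 : ∑' k, c (k + 1) ≤ ∑' k, c k := by
    rw [hcs.tsum_eq_zero_add]
    linarith [hc0 0]
  calc w ^ θ * hypSeries θ w
      = ∑' k : ℕ, w ^ θ * (w ^ k / ((k.factorial : ℝ) * Real.Gamma ((k : ℝ) + θ + 1))) := by
        rw [hypSeries, tsum_mul_left]
    _ ≤ ∑' k, 2 / (1 - θ) * (c k + c (k + 1)) :=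
        Summable.tsum_le_tsum hterm ((summable_hypSeries (by linarith) w).mul_left _)
          ((hcs.add hcs1).mul_left _)
    _ = 2 / (1 - θ) * (∑' k, c k + ∑' k, c (k + 1)) := by rw [tsum_mul_left, hcs.tsum_add hcs1]
    _ ≤ 2 / (1 - θ) * (∑' k, c k + ∑' k, c k) := by gcongr
    _ = 4 / (1 - θ) * hypSeries (-θ) w := by
        have : hypSeries (-θ) w = ∑' k, c k := rfl
        rw [this]; ring

end

end DegenerateHeat

/-! ### The one-dimensional kernel and its even and odd parts. -/

namespace DegenerateHeat

noncomputable section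

/-- The part of the heat kernel of `∂_y² + (p / y) ∂_y` that is even in `y`. -/
def evenKernel (p x y s : ℝ) : ℝ :=
  (4 * s) ^ (-(p + 1) / 2) * Real.exp (-(x ^ 2 + y ^ 2) / (4 * s)) *
    hypSeries ((p - 1) / 2) ((x * y / (4 * s)) ^ 2)

/-- The solution `y |y| ^ (-a)` of `(|y| ^ a h')' = 0`. -/
def oddPower (a y : ℝ) : ℝ := y * |y| ^ (-a)

variable {a p x y s : ℝ}

lemma oddPower_zero : oddPower a 0 = 0 := by simp [oddPower]

lemma oddPower_neg : oddPower a (-y) = -oddPower a y := by simp [oddPower]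

lemma abs_oddPower (hy : y ≠ 0) : |oddPower a y| = |y| ^ (1 - a) := by
  have h : 0 < |y| := abs_pos.2 hy
  rw [oddPower, abs_mul, abs_of_nonneg (Real.rpow_nonneg (abs_nonneg y) _), sub_eq_add_neg,
    Real.rpow_add h, Real.rpow_one]

lemma oddPower_ne_zero (hy : y ≠ 0) : oddPower a y ≠ 0 :=
  mul_ne_zero hy (Real.rpow_pos_of_pos (abs_pos.2 hy) _).ne'

lemma rpow_mul_oddPower : |y| ^ a * oddPower a y = y := by
  rcases eq_or_ne y 0 with rfl | hy
  · simp [oddPower]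
  · have h : 0 < |y| := abs_pos.2 hy
    rw [oddPower, mul_left_comm, ← Real.rpow_add h, add_neg_cancel, Real.rpow_zero, mul_one]

lemma mul_oddPower (ha : a < 2) : y * oddPower a y = |y| ^ (2 - a) := by
  rcases eq_or_ne y 0 with rfl | hy
  · rw [abs_zero, Real.zero_rpow (by linarith), zero_mul]
  · have h : 0 < |y| := abs_pos.2 hy
    rw [oddPower, ← mul_assoc, ← sq, ← sq_abs, sub_eq_add_neg, Real.rpow_add h, Real.rpow_two]

lemma hasDerivAt_abs_rpow (q : ℝ) (hy : y ≠ 0) :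
    HasDerivAt (fun y : ℝ => |y| ^ q) (q * |y| ^ q / y) y := by
  have h : 0 < |y| := abs_pos.2 hy
  convert (hasDerivAt_abs hy).rpow_const (p := q) (Or.inl h.ne') using 1
  rw [Real.rpow_sub_one h.ne']
  rcases lt_or_gt_of_ne hy with h1 | h1
  · rw [sign_neg h1, abs_of_neg h1]
    simp
    field_simp
  · rw [sign_pos h1, abs_of_pos h1]
    simp
    field_simp

lemma hasDerivAt_oddPower (hy : y ≠ 0) :
    HasDerivAt (oddPower a) ((1 - a) * |y| ^ (-a)) y := by
  refine ((hasDerivAt_id y).mul (hasDerivAt_abs_rpow (-a) hy)).congr_deriv ?_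
  simp only [id]
  field_simp
  ring

lemma continuous_oddPower (ha : a < 1) : Continuous (oddPower a) := by
  refine continuous_iff_continuousAt.2 fun y => ?_
  rcases eq_or_ne y 0 with rfl | hy
  · have h0 : Tendsto (fun y : ℝ => |y| ^ (1 - a)) (𝓝 0) (𝓝 0) := by
      have : Continuous fun y : ℝ => |y| ^ (1 - a) :=
        continuous_abs.rpow_const fun _ => Or.inr (by linarith)
      simpa [Real.zero_rpow (show (1 - a) ≠ 0 by linarith)] using this.tendsto 0
    rw [ContinuousAt, oddPower_zero]
    refine squeeze_zero_norm (fun y => ?_) h0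
    rw [Real.norm_eq_abs]
    rcases eq_or_ne y 0 with rfl | hy
    · rw [oddPower_zero, abs_zero]
      exact Real.rpow_nonneg le_rfl _
    · exact (abs_oddPower hy).le
  · exact (hasDerivAt_oddPower hy).continuousAt

/-- The two exponentials merge into exp(-(x² + y²)/(4s)), and z|z|^(-a) factors into functions of x,
y and s. The power of 4s so produced changes the exponent a of the prefactor into 2 - a. -/
lemma kernel1_eq (hs : 0 < s) :
    kernel1 a x y s =
      evenKernel a x y s + oddPower a x * oddPower a y * evenKernel (2 - a) x y s := by
  have h4 : 0 < 4 * s := by linarith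
  have e1 : Real.exp (-(x - y) ^ 2 / (4 * s)) * Real.exp (-(x * y) / (2 * s)) =
      Real.exp (-(x ^ 2 + y ^ 2) / (4 * s)) := by
    rw [← Real.exp_add]
    congr 1
    field_simp
    ring
  have e2 : x * y / (4 * s) * (|x * y| / (4 * s)) ^ (-a) =
      oddPower a x * oddPower a y * (4 * s) ^ (a - 1) := by
    rw [abs_mul, Real.div_rpow (by positivity) h4.le, Real.mul_rpow (abs_nonneg _) (abs_nonneg _),
      Real.rpow_neg h4.le, Real.rpow_sub_one h4.ne', oddPower, oddPower]
    field_simp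
  have e3 : (4 * s) ^ (-(a + 1) / 2) * (4 * s) ^ (a - 1) = (4 * s) ^ (-(2 - a + 1) / 2) := by
    rw [← Real.rpow_add h4]
    congr 1
    ring
  have e4 : -((a - 1) / 2) = (2 - a - 1) / 2 := by ring
  rw [kernel1, besselSeries_eq, besselSeries_eq, mul_assoc ((4 * s) ^ (-(a + 1) / 2)), e1, e2, e4,
    evenKernel, evenKernel, ← e3]
  ring

lemma evenKernel_nonneg (hp : -1 < p) (hs : 0 < s) : 0 ≤ evenKernel p x y s :=
  mul_nonneg (by positivity) (hypSeries_nonneg (by linarith) (sq_nonneg _))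

lemma evenKernel_neg : evenKernel p x (-y) s = evenKernel p x y s := by
  simp only [evenKernel, mul_neg, neg_div, even_two, Even.neg_pow]

/-- It has two uses: it expresses y² times a density through densities of higher exponent, and it
eliminates `evenKernel (p + 4)` when the heat equation is checked. -/
lemma evenKernel_recurrence (hp : -1 < p) (hs : 0 < s) :
    evenKernel p x y s =
      2 * s * (p + 1) * evenKernel (p + 2) x y s + x ^ 2 * y ^ 2 * evenKernel (p + 4) x y s := by
  have h4 : 0 < 4 * s := by linarith
  have e1 : (4 * s) ^ (-(p + 2 + 1) / 2) = (4 * s) ^ (-(p + 1) / 2) / (4 * s) := by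
    rw [← Real.rpow_sub_one h4.ne']
    congr 1; ring
  have e2 : (4 * s) ^ (-(p + 4 + 1) / 2) = (4 * s) ^ (-(p + 1) / 2) / (4 * s) ^ 2 := by
    rw [← Real.rpow_sub_natCast h4.ne']
    congr 1; push_cast; ring
  rw [evenKernel, evenKernel, evenKernel, e1, e2,
    hypSeries_recurrence (μ := (p - 1) / 2) (by linarith),
    show (p + 2 - 1) / 2 = (p - 1) / 2 + 1 by ring, show (p + 4 - 1) / 2 = (p - 1) / 2 + 2 by ring]
  field_simp
  ring

/-- The factor y is kept outside so that the remaining quotient has no singularity at y = 0. -/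
lemma hasDerivAt_evenKernel_space (hp : -1 < p) (hs : 0 < s) :
    HasDerivAt (fun y => evenKernel p x y s)
      (y * ((x ^ 2 * evenKernel (p + 2) x y s - evenKernel p x y s) / (2 * s))) y := by
  have h4 : 0 < 4 * s := by linarith
  have e1 : (4 * s) ^ (-(p + 2 + 1) / 2) = (4 * s) ^ (-(p + 1) / 2) / (4 * s) := by
    rw [← Real.rpow_sub_one h4.ne']
    congr 1; ring
  have h1 : HasDerivAt (fun y : ℝ => Real.exp (-(x ^ 2 + y ^ 2) / (4 * s)))
      (Real.exp (-(x ^ 2 + y ^ 2) / (4 * s)) * (-(2 * y) / (4 * s))) y := by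
    have := ((((hasDerivAt_pow 2 y).const_add (x ^ 2)).neg).div_const (4 * s)).exp
    refine this.congr_deriv ?_
    norm_num
  have h2 : HasDerivAt (fun y : ℝ => hypSeries ((p - 1) / 2) ((x * y / (4 * s)) ^ 2))
      (hypSeries ((p - 1) / 2 + 1) ((x * y / (4 * s)) ^ 2) *
        (2 * (x * y / (4 * s)) * (x / (4 * s)))) y := by
    have h3 : HasDerivAt (fun y : ℝ => (x * y / (4 * s)) ^ 2)
        (2 * (x * y / (4 * s)) * (x / (4 * s))) y := by
      refine ((((hasDerivAt_id y).const_mul x).div_const (4 * s)).pow 2).congr_deriv ?_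
      simp
    exact (hasDerivAt_hypSeries (by linarith) _).comp y h3
  refine ((h1.const_mul ((4 * s) ^ (-(p + 1) / 2))).mul h2).congr_deriv ?_
  rw [evenKernel, evenKernel, e1, show (p + 2 - 1) / 2 = (p - 1) / 2 + 1 by ring]
  field_simp
  ring

lemma hasDerivAt_evenKernel_time (hp : -1 < p) (hs : 0 < s) :
    HasDerivAt (fun s => evenKernel p x y s)
      ((-(p + 1) / (2 * s) + (x ^ 2 + y ^ 2) / (4 * s ^ 2)) * evenKernel p x y s -
        x ^ 2 * y ^ 2 / (2 * s ^ 2) * evenKernel (p + 2) x y s) s := by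
  have h4 : 0 < 4 * s := by linarith
  have e1 : (4 * s) ^ (-(p + 2 + 1) / 2) = (4 * s) ^ (-(p + 1) / 2) / (4 * s) := by
    rw [← Real.rpow_sub_one h4.ne']
    congr 1; ring
  have h4s : HasDerivAt (fun s : ℝ => 4 * s) 4 s := by
    simpa using (hasDerivAt_id s).const_mul 4
  have h0 : HasDerivAt (fun s : ℝ => (4 * s) ^ (-(p + 1) / 2))
      ((4 * s) ^ (-(p + 1) / 2) * (-(p + 1) / (2 * s))) s := by
    refine (h4s.rpow_const (Or.inl h4.ne')).congr_deriv ?_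
    rw [Real.rpow_sub_one h4.ne']
    field_simp
  have hinv : ∀ c : ℝ, HasDerivAt (fun s : ℝ => c / (4 * s)) (-c / (4 * s ^ 2)) s := by
    intro c
    refine ((hasDerivAt_const s c).div h4s h4.ne').congr_deriv ?_
    field_simp
    ring
  have h1 := (hinv (-(x ^ 2 + y ^ 2))).exp
  have h2 : HasDerivAt (fun s : ℝ => hypSeries ((p - 1) / 2) ((x * y / (4 * s)) ^ 2))
      (hypSeries ((p - 1) / 2 + 1) ((x * y / (4 * s)) ^ 2) *
        (2 * (x * y / (4 * s)) * (-(x * y) / (4 * s ^ 2)))) s := by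
    have h3 : HasDerivAt (fun s : ℝ => (x * y / (4 * s)) ^ 2)
        (2 * (x * y / (4 * s)) * (-(x * y) / (4 * s ^ 2))) s := by
      refine ((hinv (x * y)).pow 2).congr_deriv ?_
      simp
    exact (hasDerivAt_hypSeries (by linarith) _).comp s h3
  refine ((h0.mul h1).mul h2).congr_deriv ?_
  rw [evenKernel, evenKernel, e1, show (p + 2 - 1) / 2 = (p - 1) / 2 + 1 by ring]
  simp only [Pi.mul_apply]
  field_simp
  ring

lemma differentiableAt_evenKernel (hp : -1 < p) (x : ℝ) {q : ℝ × ℝ} (hq : 0 < q.2) :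
    DifferentiableAt ℝ (fun q : ℝ × ℝ => evenKernel p x q.1 q.2) q := by
  have h4 : 4 * q.2 ≠ 0 := by positivity
  have h1 : DifferentiableAt ℝ (fun q : ℝ × ℝ => (4 * q.2) ^ (-(p + 1) / 2)) q :=
    (differentiableAt_snd.const_mul 4).rpow_const (Or.inl h4)
  have h2 : DifferentiableAt ℝ (fun q : ℝ × ℝ => Real.exp (-(x ^ 2 + q.1 ^ 2) / (4 * q.2))) q := by
    fun_prop (disch := exact h4)
  have h3 : DifferentiableAt ℝ (fun q : ℝ × ℝ => (x * q.1 / (4 * q.2)) ^ 2) q := by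
    fun_prop (disch := exact h4)
  have h5 : DifferentiableAt ℝ
      (fun q : ℝ × ℝ => hypSeries ((p - 1) / 2) ((x * q.1 / (4 * q.2)) ^ 2)) q :=
    ((hasDerivAt_hypSeries (by linarith) _).differentiableAt).comp q h3
  exact (h1.mul h2).mul h5

lemma continuous_evenKernel (hp : -1 < p) (hs : 0 < s) :
    Continuous fun y => evenKernel p x y s :=
  continuous_iff_continuousAt.2 fun _ => (hasDerivAt_evenKernel_space hp hs).continuousAt

/-- Expanding the series, each term is a Gamma integral. Its Γ cancels the one in the denominator
and leaves the Poisson weight e^(-w) w^k / k! with w = x² / (4s); these weights sum to one. -/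
lemma integral_evenKernel (hp : -1 < p) (hs : 0 < s) (x : ℝ) :
    ∫ y, evenKernel p x y s * |y| ^ p = 1 := by
  have h4 : 0 < 4 * s := by linarith
  set w : ℝ := x ^ 2 / (4 * s) with hw
  set F : ℕ → ℝ → ℝ := fun k y => (4 * s) ^ (-(p + 1) / 2) * Real.exp (-w) *
    (w ^ k * (4 * s)⁻¹ ^ k / ((k.factorial : ℝ) * Real.Gamma ((k : ℝ) + (p - 1) / 2 + 1))) *
      (|y| ^ (p + 2 * k) * Real.exp (-(4 * s)⁻¹ * |y| ^ (2 : ℝ))) with hF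
  have hF0 : ∀ k y, 0 ≤ F k y := fun k y => by
    have := gamma_nat_add_pos (μ := (p - 1) / 2) (by linarith) k
    simp only [hF]
    positivity
  have hint : ∀ k, ∫ y, F k y = Real.exp (-w) * (w ^ k / k.factorial) := by
    intro k
    have hk0 : (0 : ℝ) ≤ k := k.cast_nonneg
    have hG := gamma_nat_add_pos (μ := (p - 1) / 2) (by linarith) k
    simp only [hF]
    rw [integral_const_mul,
      integral_comp_abs (f := fun r => r ^ (p + 2 * k) * Real.exp (-(4 * s)⁻¹ * r ^ (2 : ℝ))),
      integral_rpow_mul_exp_neg_mul_rpow (by norm_num) (by linarith) (by positivity)]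
    have e1 : (p + 2 * (k : ℝ) + 1) / 2 = (k : ℝ) + (p - 1) / 2 + 1 := by ring
    have e2 : ((4 * s)⁻¹ : ℝ) ^ (-(p + 2 * (k : ℝ) + 1) / 2) =
        (4 * s) ^ ((p + 1) / 2) * (4 * s) ^ k := by
      rw [Real.inv_rpow h4.le, ← Real.rpow_neg h4.le, ← Real.rpow_natCast, ← Real.rpow_add h4]
      congr 1
      ring
    have e3 : (4 * s) ^ (-(p + 1) / 2) = ((4 * s) ^ ((p + 1) / 2))⁻¹ := by
      rw [← Real.rpow_neg h4.le]
      congr 1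
      ring
    have hpos : 0 < (4 * s) ^ ((p + 1) / 2) := Real.rpow_pos_of_pos h4 _
    rw [e1, e2, e3, inv_pow]
    generalize Real.Gamma ((k : ℝ) + (p - 1) / 2 + 1) = G at hG ⊢
    field_simp
  have hFi : ∀ k, Integrable (F k) := by
    intro k
    -- Integrability is read off from a nonzero value of the integral. The value vanishes only when
    -- w = 0 and k > 0, and then the term itself is zero.
    rcases eq_or_ne w 0 with h0 | h0
    · rcases Nat.eq_zero_or_pos k with rfl | hk
      · exact Integrable.of_integral_ne_zero (by rw [hint]; simp)
      · have : F k = fun _ => 0 := by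
          funext y
          simp [hF, h0, hk.ne']
        rw [this]
        exact integrable_zero _ _ _
    · refine Integrable.of_integral_ne_zero ?_
      rw [hint]
      positivity
  have hnorm : ∀ k, ∫ y, ‖F k y‖ = Real.exp (-w) * (w ^ k / k.factorial) := by
    intro k
    rw [← hint k]
    exact integral_congr_ae (Eventually.of_forall fun y => by
      simp only [Real.norm_eq_abs, abs_of_nonneg (hF0 k y)])
  have hexp : HasSum (fun k : ℕ => Real.exp (-w) * (w ^ k / k.factorial)) 1 := by
    have h0 : HasSum (fun k : ℕ => w ^ k / (k.factorial : ℝ)) (Real.exp w) := by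
      rw [Real.exp_eq_exp_ℝ]
      exact NormedSpace.expSeries_div_hasSum_exp w
    have h := h0.mul_left (Real.exp (-w))
    rwa [← Real.exp_add, neg_add_cancel, Real.exp_zero] at h
  have hsum := hasSum_integral_of_summable_integral_norm hFi (by
    simp only [hnorm]
    exact hexp.summable)
  simp only [hint] at hsum
  rw [← hsum.unique hexp]
  refine integral_congr_ae ?_
  have hae : ∀ᵐ y : ℝ, y ≠ 0 := by simp [ae_iff, measure_singleton]
  filter_upwards [hae] with y hy
  have hy' : 0 < |y| := abs_pos.2 hy
  simp only [hF]
  rw [evenKernel, hypSeries, ← tsum_mul_left, ← tsum_mul_right]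
  refine tsum_congr fun k => ?_
  have e1 : Real.exp (-(x ^ 2 + y ^ 2) / (4 * s)) =
      Real.exp (-w) * Real.exp (-(4 * s)⁻¹ * |y| ^ (2 : ℝ)) := by
    rw [← Real.exp_add, Real.rpow_two, sq_abs, hw]
    congr 1
    field_simp
    ring
  have e2 : |y| ^ (p + 2 * (k : ℝ)) = |y| ^ p * (y ^ 2) ^ k := by
    rw [Real.rpow_add hy', show (2 * (k : ℝ)) = ((2 * k : ℕ) : ℝ) by push_cast; ring,
      Real.rpow_natCast, pow_mul, sq_abs]
  have e3 : ((x * y / (4 * s)) ^ 2) ^ k = w ^ k * (4 * s)⁻¹ ^ k * (y ^ 2) ^ k := by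
    rw [← mul_pow, ← mul_pow, hw]
    congr 1
    field_simp
  rw [e1, e2, e3]
  ring

/-- This is the inequality I_θ ≤ C I_{-θ} at θ = (1 - a)/2, since |h(x) h(y)| (4s)^(a-1) = |z|^(1-a)
= (z²)^θ for z = xy/(4s). It replaces positivity of the kernel, as the odd summand changes sign with
xy. -/
lemma abs_oddPower_mul_evenKernel_le (ha : -1 < a) (ha' : a < 1) (hs : 0 < s) :
    |oddPower a x * oddPower a y * evenKernel (2 - a) x y s| ≤
      8 / (1 + a) * evenKernel a x y s := by
  have h4 : 0 < 4 * s := by linarith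
  have hE : 0 ≤ evenKernel a x y s := evenKernel_nonneg ha hs
  have hb := rpow_mul_hypSeries_le (θ := (1 - a) / 2) (w := (x * y / (4 * s)) ^ 2)
    (by linarith) (by linarith) (sq_nonneg _)
  rcases eq_or_ne x 0 with rfl | hx
  · rw [oddPower_zero, zero_mul, zero_mul, abs_zero]
    have : 0 < 1 + a := by linarith
    positivity
  rcases eq_or_ne y 0 with rfl | hy
  · rw [oddPower_zero, mul_zero, zero_mul, abs_zero]
    have : 0 < 1 + a := by linarith
    positivity
  rw [abs_mul, abs_mul, abs_of_nonneg (evenKernel_nonneg (by linarith) hs), abs_oddPower hx,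
    abs_oddPower hy]
  have e1 : ((x * y / (4 * s)) ^ 2) ^ ((1 - a) / 2) =
      |x| ^ (1 - a) * |y| ^ (1 - a) * (4 * s) ^ (a - 1) := by
    rw [← sq_abs, ← Real.rpow_two, ← Real.rpow_mul (abs_nonneg _), abs_div, abs_mul, abs_of_pos h4,
      Real.div_rpow (by positivity) h4.le, Real.mul_rpow (abs_nonneg _) (abs_nonneg _),
      show 2 * ((1 - a) / 2) = 1 - a by ring, show a - 1 = -(1 - a) by ring, Real.rpow_neg h4.le]
    rfl
  have e3 : (4 * s) ^ (-(2 - a + 1) / 2) = (4 * s) ^ (-(a + 1) / 2) * (4 * s) ^ (a - 1) := by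
    rw [← Real.rpow_add h4]
    congr 1
    ring
  have e4 : 4 / (1 - (1 - a) / 2) = 8 / (1 + a) := by
    rw [div_eq_div_iff (by linarith) (by linarith)]
    ring
  rw [e1, e4, show -((1 - a) / 2) = (a - 1) / 2 by ring] at hb
  rw [evenKernel, evenKernel, e3, show (2 - a - 1) / 2 = (1 - a) / 2 by ring]
  calc _ = (4 * s) ^ (-(a + 1) / 2) * Real.exp (-(x ^ 2 + y ^ 2) / (4 * s)) *
        (|x| ^ (1 - a) * |y| ^ (1 - a) * (4 * s) ^ (a - 1) *
          hypSeries ((1 - a) / 2) ((x * y / (4 * s)) ^ 2)) := by ring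
    _ ≤ (4 * s) ^ (-(a + 1) / 2) * Real.exp (-(x ^ 2 + y ^ 2) / (4 * s)) *
        (8 / (1 + a) * hypSeries ((a - 1) / 2) ((x * y / (4 * s)) ^ 2)) := by gcongr
    _ = _ := by ring

end

end DegenerateHeat

/-! ### Concentration of mass and the initial trace. -/

namespace DegenerateHeat

noncomputable section

/-- The heat kernel of `ℝⁿ⁻¹`. -/
def heatKernel (n : ℕ) (v : EuclideanSpace ℝ (Fin (n - 1))) (s : ℝ) : ℝ :=
  (4 * Real.pi * s) ^ (-((n : ℝ) - 1) / 2) * Real.exp (-‖v‖ ^ 2 / (4 * s))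

variable {n : ℕ} {a p x y s : ℝ}

lemma Γ_of_lt {X Y : Space n} {t τ : ℝ} (h : τ < t) :
    Γ n a X t Y τ = heatKernel n (X.1 - Y.1) (t - τ) * kernel1 a X.2 Y.2 (t - τ) := by
  rw [Γ, if_pos h, heatKernel]

lemma heatKernel_nonneg (hs : 0 < s) (v : EuclideanSpace ℝ (Fin (n - 1))) :
    0 ≤ heatKernel n v s := by
  rw [heatKernel]; positivity

lemma continuous_heatKernel : Continuous fun v => heatKernel n v s := by
  unfold heatKernel; fun_prop

lemma integral_heatKernel (hn : 1 ≤ n) (hs : 0 < s) : ∫ v, heatKernel n v s = 1 := by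
  have h4 : 0 < 4 * Real.pi * s := by positivity
  have h := GaussianFourier.integral_rexp_neg_mul_sq_norm
    (V := EuclideanSpace ℝ (Fin (n - 1))) (b := (4 * s)⁻¹) (by positivity)
  have e1 : ∀ v : EuclideanSpace ℝ (Fin (n - 1)),
      Real.exp (-‖v‖ ^ 2 / (4 * s)) = Real.exp (-(4 * s)⁻¹ * ‖v‖ ^ 2) := by
    intro v; congr 1; field_simp
  simp only [heatKernel, integral_const_mul, e1, h]
  rw [finrank_euclideanSpace_fin, Nat.cast_sub hn, Nat.cast_one,
    show Real.pi / (4 * s)⁻¹ = 4 * Real.pi * s by field_simp, ← Real.rpow_add h4,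
    show -((n : ℝ) - 1) / 2 + ((n : ℝ) - 1) / 2 = 0 by ring, Real.rpow_zero]

lemma integral_heatKernel_sub (hn : 1 ≤ n) (hs : 0 < s) (x : EuclideanSpace ℝ (Fin (n - 1))) :
    ∫ y, heatKernel n (x - y) s = 1 := by
  rw [integral_sub_left_eq_self (fun v => heatKernel n v s), integral_heatKernel hn hs]

/-- Half of the Gaussian exponent absorbs ‖v‖² by t e^(-t) ≤ 1; the other half is the exponent at
time 2s. -/
lemma heatKernel_mul_sq_le (hs : 0 < s) (v : EuclideanSpace ℝ (Fin (n - 1))) :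
    heatKernel n v s * ‖v‖ ^ 2 ≤
      8 * s * 2 ^ (((n : ℝ) - 1) / 2) * heatKernel n v (2 * s) := by
  have hpi := Real.pi_pos
  have e1 : (4 * Real.pi * (2 * s)) ^ (-((n : ℝ) - 1) / 2) =
      2 ^ (-((n : ℝ) - 1) / 2) * (4 * Real.pi * s) ^ (-((n : ℝ) - 1) / 2) := by
    rw [← Real.mul_rpow (by norm_num) (by positivity)]
    congr 1; ring
  have e2 : (2 : ℝ) ^ (((n : ℝ) - 1) / 2) * 2 ^ (-((n : ℝ) - 1) / 2) = 1 := by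
    rw [← Real.rpow_add (by norm_num), neg_div, add_neg_cancel, Real.rpow_zero]
  have e3 : Real.exp (-‖v‖ ^ 2 / (4 * s)) * ‖v‖ ^ 2 ≤
      8 * s * Real.exp (-‖v‖ ^ 2 / (4 * (2 * s))) := by
    set t : ℝ := ‖v‖ ^ 2 / (8 * s) with ht
    have h1 : -‖v‖ ^ 2 / (4 * (2 * s)) = -t := by rw [ht]; field_simp; ring
    have h2 : -‖v‖ ^ 2 / (4 * s) = -t + -t := by rw [ht]; field_simp; ring
    have h3 : ‖v‖ ^ 2 = 8 * s * t := by rw [ht]; field_simp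
    rw [h1, h2, h3, Real.exp_add]
    have h4 : t * Real.exp (-t) ≤ 1 := by
      have h5 := Real.add_one_le_exp t
      rw [Real.exp_neg, ← div_eq_mul_inv, div_le_one (Real.exp_pos _)]
      linarith
    calc _ = 8 * s * Real.exp (-t) * (t * Real.exp (-t)) := by ring
      _ ≤ 8 * s * Real.exp (-t) * 1 := by gcongr
      _ = _ := by ring
  rw [heatKernel, heatKernel, e1]
  calc _ = (4 * Real.pi * s) ^ (-((n : ℝ) - 1) / 2) *
        (Real.exp (-‖v‖ ^ 2 / (4 * s)) * ‖v‖ ^ 2) := by ring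
    _ ≤ (4 * Real.pi * s) ^ (-((n : ℝ) - 1) / 2) *
        (8 * s * Real.exp (-‖v‖ ^ 2 / (4 * (2 * s)))) := by gcongr
    _ = (2 ^ (((n : ℝ) - 1) / 2) * 2 ^ (-((n : ℝ) - 1) / 2)) *
        (4 * Real.pi * s) ^ (-((n : ℝ) - 1) / 2) *
        (8 * s * Real.exp (-‖v‖ ^ 2 / (4 * (2 * s)))) := by rw [e2, one_mul]
    _ = _ := by ring

/-- The probability density on `ℝⁿ` built from a heat kernel and an even kernel. -/
def evenDensity (n : ℕ) (p : ℝ) (X : Space n) (r s : ℝ) (Y : Space n) : ℝ :=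
  heatKernel n (X.1 - Y.1) r * (evenKernel p X.2 Y.2 s * |Y.2| ^ p)

variable {X : Space n} {r : ℝ}

lemma integral_evenDensity (hn : 1 ≤ n) (hp : -1 < p) (hr : 0 < r) (hs : 0 < s) :
    ∫ Y, evenDensity n p X r s Y = 1 := by
  simp only [evenDensity]
  rw [Measure.volume_eq_prod,
    integral_prod_mul (fun v => heatKernel n (X.1 - v) r)
      (fun y => evenKernel p X.2 y s * |y| ^ p),
    integral_heatKernel_sub hn hr, integral_evenKernel hp hs, one_mul]

lemma integrable_evenDensity (hn : 1 ≤ n) (hp : -1 < p) (hr : 0 < r) (hs : 0 < s) :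
    Integrable (evenDensity n p X r s) :=
  Integrable.of_integral_ne_zero (by rw [integral_evenDensity hn hp hr hs]; exact one_ne_zero)

lemma evenDensity_nonneg (hp : -1 < p) (hr : 0 < r) (hs : 0 < s) (Y : Space n) :
    0 ≤ evenDensity n p X r s Y :=
  mul_nonneg (heatKernel_nonneg hr _) (mul_nonneg (evenKernel_nonneg hp hs) (by positivity))

/-- Since every density on the right has mass one, moments in y can be read off as sums of
coefficients. -/
lemma evenDensity_mul_sq (hp : -1 < p) (hs : 0 < s) (Y : Space n) :
    evenDensity n p X r s Y * Y.2 ^ 2 =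
      2 * s * (p + 1) * evenDensity n (p + 2) X r s Y +
        X.2 ^ 2 * evenDensity n (p + 4) X r s Y := by
  have e : ∀ q : ℝ, -1 < q → |Y.2| ^ (q + 2) = |Y.2| ^ q * Y.2 ^ 2 := by
    intro q hq
    rcases eq_or_ne Y.2 0 with h0 | h0
    · rw [h0, abs_zero, Real.zero_rpow (by linarith)]
      ring
    · rw [Real.rpow_add (abs_pos.2 h0), Real.rpow_two, sq_abs]
  have e4 : |Y.2| ^ (p + 4) = |Y.2| ^ p * Y.2 ^ 2 * Y.2 ^ 2 := by
    rw [show p + 4 = p + 2 + 2 by ring, e (p + 2) (by linarith), e p hp]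
  rw [evenDensity, evenDensity, evenDensity, evenKernel_recurrence hp hs, e p hp, e4]
  ring

lemma integrable_add_integral_eq {α : Type*} [MeasurableSpace α] {μ : Measure α} {f g : α → ℝ}
    {c d : ℝ} (hf : Integrable f μ ∧ ∫ z, f z ∂μ = c) (hg : Integrable g μ ∧ ∫ z, g z ∂μ = d) :
    Integrable (fun z => f z + g z) μ ∧ ∫ z, f z + g z ∂μ = c + d :=
  ⟨hf.1.add hg.1, by rw [integral_add hf.1 hg.1, hf.2, hg.2]⟩

lemma evenDensity_const_mul (hn : 1 ≤ n) (hp : -1 < p) (hr : 0 < r) (hs : 0 < s) (c : ℝ) :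
    Integrable (fun Y => c * evenDensity n p X r s Y) ∧
      ∫ Y, c * evenDensity n p X r s Y = c :=
  ⟨(integrable_evenDensity hn hp hr hs).const_mul c, by
    rw [integral_const_mul, integral_evenDensity hn hp hr hs, mul_one]⟩

/-- The function controlling the distance of `Y` from the two points `(x', ±x)`. -/
def reflDist (X Y : Space n) : ℝ := ‖X.1 - Y.1‖ ^ 2 + (Y.2 ^ 2 - X.2 ^ 2) ^ 2

lemma reflDist_nonneg (X Y : Space n) : 0 ≤ reflDist X Y := by
  rw [reflDist]; positivity

/-- A bound for the integral of `reflDist X` against `evenDensity n a X s s`. -/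
def reflMoment (n : ℕ) (a x s : ℝ) : ℝ :=
  8 * s * 2 ^ (((n : ℝ) - 1) / 2) + (8 * x ^ 2 * s + 4 * (a + 1) * (a + 3) * s ^ 2)

lemma tendsto_reflMoment (n : ℕ) (a x : ℝ) :
    Tendsto (reflMoment n a x) (𝓝[>] 0) (𝓝 0) := by
  have h : Continuous (reflMoment n a x) := by unfold reflMoment; fun_prop
  have h1 := h.tendsto 0
  have h2 : reflMoment n a x 0 = 0 := by simp [reflMoment]
  rw [h2] at h1
  exact h1.mono_left nhdsWithin_le_nhds

/-- Only y² is controlled, because the even density does not distinguish x from -x. Applying the y²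
identity twice writes (y² - x²)² times the density as a combination of the densities with exponents
a, a + 2, …, a + 8. The tangential term is bounded by the heat kernel at time 2s, for which
`evenDensity` carries two separate times. -/
lemma exists_reflDist_majorant (hn : 1 ≤ n) (ha : -1 < a) (hs : 0 < s) (X : Space n) :
    ∃ B : Space n → ℝ, Integrable B ∧ ∫ Y, B Y = reflMoment n a X.2 s ∧
      ∀ Y, evenDensity n a X s s Y * reflDist X Y ≤ B Y := by
  set D : ℝ → Space n → ℝ := fun p => evenDensity n p X s s with hD
  set x : ℝ := X.2 with hx
  have hB := integrable_add_integral_eq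
    (evenDensity_const_mul (X := X) hn ha (show 0 < 2 * s by linarith) hs
      (8 * s * 2 ^ (((n : ℝ) - 1) / 2)))
    (integrable_add_integral_eq (evenDensity_const_mul (X := X) hn ha hs hs (x ^ 4))
    (integrable_add_integral_eq (evenDensity_const_mul (X := X) (p := a + 2) hn (by linarith) hs hs
      (-(4 * s * (a + 1) * x ^ 2)))
    (integrable_add_integral_eq (evenDensity_const_mul (X := X) (p := a + 4) hn (by linarith) hs hs
      (4 * s ^ 2 * (a + 1) * (a + 3) - 2 * x ^ 4))
    (integrable_add_integral_eq (evenDensity_const_mul (X := X) (p := a + 6) hn (by linarith) hs hs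
      (4 * s * (a + 3) * x ^ 2))
    (evenDensity_const_mul (X := X) (p := a + 8) hn (by linarith) hs hs (x ^ 4))))))
  refine ⟨_, hB.1, ?_, ?_⟩
  -- The coefficients of x⁴ add up to 1 - 2 + 1 = 0, so every remaining term carries a factor s.
  · rw [hB.2, reflMoment]
    ring
  · intro Y
    have h1 : D a Y * ‖X.1 - Y.1‖ ^ 2 ≤
        8 * s * 2 ^ (((n : ℝ) - 1) / 2) * evenDensity n a X (2 * s) s Y := by
      have h2 := heatKernel_mul_sq_le hs (X.1 - Y.1)
      have h3 : 0 ≤ evenKernel a X.2 Y.2 s * |Y.2| ^ a :=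
        mul_nonneg (evenKernel_nonneg ha hs) (by positivity)
      calc D a Y * ‖X.1 - Y.1‖ ^ 2 = (heatKernel n (X.1 - Y.1) s * ‖X.1 - Y.1‖ ^ 2) *
            (evenKernel a X.2 Y.2 s * |Y.2| ^ a) := by simp only [hD, evenDensity]; ring
        _ ≤ (8 * s * 2 ^ (((n : ℝ) - 1) / 2) * heatKernel n (X.1 - Y.1) (2 * s)) *
            (evenKernel a X.2 Y.2 s * |Y.2| ^ a) := by gcongr
        _ = _ := by rw [evenDensity]; ring
    have h4 : D a Y * Y.2 ^ 2 = 2 * s * (a + 1) * D (a + 2) Y + x ^ 2 * D (a + 4) Y :=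
      evenDensity_mul_sq ha hs Y
    have h5 : D (a + 2) Y * Y.2 ^ 2 = 2 * s * (a + 3) * D (a + 4) Y + x ^ 2 * D (a + 6) Y := by
      have := evenDensity_mul_sq (X := X) (r := s) (p := a + 2) (by linarith) hs Y
      rw [show a + 2 + 1 = a + 3 by ring, show a + 2 + 2 = a + 4 by ring,
        show a + 2 + 4 = a + 6 by ring] at this
      exact this
    have h6 : D (a + 4) Y * Y.2 ^ 2 = 2 * s * (a + 5) * D (a + 6) Y + x ^ 2 * D (a + 8) Y := by
      have := evenDensity_mul_sq (X := X) (r := s) (p := a + 4) (by linarith) hs Y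
      rw [show a + 4 + 1 = a + 5 by ring, show a + 4 + 2 = a + 6 by ring,
        show a + 4 + 4 = a + 8 by ring] at this
      exact this
    have h7 : D a Y * (Y.2 ^ 2 - x ^ 2) ^ 2 =
        x ^ 4 * D a Y + (-(4 * s * (a + 1) * x ^ 2) * D (a + 2) Y +
        ((4 * s ^ 2 * (a + 1) * (a + 3) - 2 * x ^ 4) * D (a + 4) Y +
        (4 * s * (a + 3) * x ^ 2 * D (a + 6) Y + x ^ 4 * D (a + 8) Y))) := by
      linear_combination (Y.2 ^ 2 - 2 * x ^ 2) * h4 + 2 * s * (a + 1) * h5 + x ^ 2 * h6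
    change D a Y * reflDist X Y ≤ _
    rw [reflDist, mul_add, h7]
    linarith

/-- The density `Γ(X, s; Y, 0) |y| ^ a`. -/
def kernelDensity (n : ℕ) (a : ℝ) (X : Space n) (s : ℝ) (Y : Space n) : ℝ :=
  heatKernel n (X.1 - Y.1) s * kernel1 a X.2 Y.2 s * |Y.2| ^ a

lemma abs_kernelDensity_le (ha : -1 < a) (ha' : a < 1) (hs : 0 < s) (Y : Space n) :
    |kernelDensity n a X s Y| ≤ (1 + 8 / (1 + a)) * evenDensity n a X s s Y := by
  have h1 := abs_oddPower_mul_evenKernel_le (x := X.2) (y := Y.2) ha ha' hs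
  have h2 := heatKernel_nonneg hs (X.1 - Y.1)
  have h3 : (0 : ℝ) ≤ |Y.2| ^ a := by positivity
  have h4 : |kernel1 a X.2 Y.2 s| ≤ (1 + 8 / (1 + a)) * evenKernel a X.2 Y.2 s := by
    rw [kernel1_eq hs]
    refine (abs_add_le _ _).trans ?_
    rw [abs_of_nonneg (evenKernel_nonneg ha hs)]
    linarith
  rw [kernelDensity, abs_mul, abs_mul, abs_of_nonneg h2, abs_of_nonneg h3, evenDensity]
  calc _ ≤ heatKernel n (X.1 - Y.1) s * ((1 + 8 / (1 + a)) * evenKernel a X.2 Y.2 s) *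
        |Y.2| ^ a := by gcongr
    _ = _ := by ring

lemma measurable_kernelDensity (ha : -1 < a) (ha' : a < 1) (hs : 0 < s) :
    Measurable (kernelDensity n a X s) := by
  have h1 : Measurable fun Y : Space n => heatKernel n (X.1 - Y.1) s :=
    (continuous_heatKernel.comp (by fun_prop)).measurable
  have h2 : Measurable fun Y : Space n => kernel1 a X.2 Y.2 s := by
    simp only [kernel1_eq hs]
    have c1 := (continuous_evenKernel (x := X.2) ha hs)
    have c2 := (continuous_evenKernel (p := 2 - a) (x := X.2) (by linarith) hs)
    have c3 := continuous_oddPower ha'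
    have c4 : Continuous fun y => evenKernel a X.2 y s +
        oddPower a X.2 * oddPower a y * evenKernel (2 - a) X.2 y s :=
      c1.add ((continuous_const.mul c3).mul c2)
    exact (c4.comp continuous_snd).measurable
  have h3 : Measurable fun Y : Space n => |Y.2| ^ a :=
    (measurable_snd.norm).pow_const a
  exact (h1.mul h2).mul h3

lemma kernelDensity_mul_bound (hn : 1 ≤ n) (ha : -1 < a) (ha' : a < 1) (hs : 0 < s)
    {f : Space n → ℝ} (hf : Measurable f) {ε C : ℝ} (hC : 0 ≤ C)
    (hb : ∀ Y, |f Y| ≤ ε + C * reflDist X Y) :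
    Integrable (fun Y => kernelDensity n a X s Y * f Y) ∧
      |∫ Y, kernelDensity n a X s Y * f Y| ≤
        (1 + 8 / (1 + a)) * (ε + C * reflMoment n a X.2 s) := by
  obtain ⟨B, hBi, hBv, hB⟩ := exists_reflDist_majorant hn ha hs X
  have hDi := integrable_evenDensity (X := X) hn ha hs hs
  have hMi : Integrable fun Y => (1 + 8 / (1 + a)) * (ε * evenDensity n a X s s Y + C * B Y) :=
    ((hDi.const_mul ε).add (hBi.const_mul C)).const_mul _
  have hle : ∀ Y, ‖kernelDensity n a X s Y * f Y‖ ≤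
      (1 + 8 / (1 + a)) * (ε * evenDensity n a X s s Y + C * B Y) := by
    intro Y
    have h1 := abs_kernelDensity_le (X := X) ha ha' hs Y
    have h2 := evenDensity_nonneg (X := X) ha hs hs Y
    have h3 : 0 ≤ 1 + 8 / (1 + a) := by
      have : 0 < 1 + a := by linarith
      positivity
    rw [norm_mul, Real.norm_eq_abs, Real.norm_eq_abs]
    calc _ ≤ ((1 + 8 / (1 + a)) * evenDensity n a X s s Y) * (ε + C * reflDist X Y) :=
          mul_le_mul h1 (hb Y) (abs_nonneg _) (mul_nonneg h3 h2)
      _ = (1 + 8 / (1 + a)) * (ε * evenDensity n a X s s Y +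
          C * (evenDensity n a X s s Y * reflDist X Y)) := by ring
      _ ≤ _ := by
        gcongr
        exact hB Y
  refine ⟨hMi.mono' ((measurable_kernelDensity ha ha' hs).mul hf).aestronglyMeasurable
    (Eventually.of_forall hle), ?_⟩
  rw [← Real.norm_eq_abs]
  refine (norm_integral_le_of_norm_le hMi (Eventually.of_forall hle)).trans (le_of_eq ?_)
  rw [integral_const_mul, integral_add (hDi.const_mul ε) (hBi.const_mul C), integral_const_mul,
    integral_const_mul, hBv, integral_evenDensity hn ha hs hs, mul_one]

/-- With u = y² - x² this follows from u ≤ 1 + u². Quadratic growth in y is thereby covered by the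
moment bound. -/
lemma growth_le_reflDist (X Y : Space n) : 1 + Y.2 ^ 2 ≤ 2 + X.2 ^ 2 + reflDist X Y := by
  rw [reflDist]
  nlinarith [sq_nonneg (Y.2 ^ 2 - X.2 ^ 2 - 1), sq_nonneg (Y.2 ^ 2 - X.2 ^ 2),
    sq_nonneg ‖X.1 - Y.1‖]

lemma integrable_kernelDensity_mul (hn : 1 ≤ n) (ha : -1 < a) (ha' : a < 1) (hs : 0 < s)
    {f : Space n → ℝ} (hf : Measurable f) {M : ℝ} (hb : ∀ Y, |f Y| ≤ M * (1 + Y.2 ^ 2)) :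
    Integrable (fun Y => kernelDensity n a X s Y * f Y) := by
  have hM : 0 ≤ M := by
    have := (abs_nonneg _).trans (hb 0)
    simpa using this
  refine (kernelDensity_mul_bound (ε := M * (2 + X.2 ^ 2)) hn ha ha' hs hf hM fun Y => ?_).1
  have := growth_le_reflDist X Y
  nlinarith [hb Y]

/-- Close to the two zeros continuity gives ε. Elsewhere `reflDist` is bounded below, so a large
multiple of it dominates the quadratic growth. -/
lemma exists_le_add_reflDist {f : Space n → ℝ} (hf : Continuous f) {M : ℝ}
    (hb : ∀ Y, |f Y| ≤ M * (1 + Y.2 ^ 2)) (h1 : f (X.1, X.2) = 0) (h2 : f (X.1, -X.2) = 0)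
    {ε : ℝ} (hε : 0 < ε) : ∃ C, 0 ≤ C ∧ ∀ Y, |f Y| ≤ ε + C * reflDist X Y := by
  have hM : 0 ≤ M := by
    have := (abs_nonneg _).trans (hb 0)
    simpa using this
  have key : ∀ z, f (X.1, z) = 0 → ∃ δ > 0, ∀ Y : Space n, ‖X.1 - Y.1‖ < δ → |Y.2 - z| < δ →
      |f Y| < ε := by
    intro z hz
    obtain ⟨δ, hδ, h⟩ := Metric.continuousAt_iff.1 (hf.continuousAt (x := (X.1, z))) ε hε
    refine ⟨δ, hδ, fun Y hY1 hY2 => ?_⟩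
    have h3 : dist Y (X.1, z) < δ := by
      rw [Prod.dist_eq, max_lt_iff]
      refine ⟨?_, ?_⟩
      · rw [dist_comm, dist_eq_norm]; exact hY1
      · rw [Real.dist_eq]; exact hY2
    have h4 := h h3
    rwa [hz, Real.dist_eq, sub_zero] at h4
  obtain ⟨δ₁, hδ₁, H1⟩ := key _ h1
  obtain ⟨δ₂, hδ₂, H2⟩ := key _ h2
  set δ := min δ₁ δ₂ with hδd
  have hδ : 0 < δ := lt_min hδ₁ hδ₂
  -- The fourth power serves the y variable: |y² - x²| = |y - x||y + x| < δ² forces one of the two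
  -- factors below δ.
  set η := min (δ ^ 2) (δ ^ 4) with hηd
  have hη : 0 < η := lt_min (by positivity) (by positivity)
  have near : ∀ Y : Space n, reflDist X Y < η → |f Y| < ε := by
    intro Y hY
    have hq1 : ‖X.1 - Y.1‖ ^ 2 < δ ^ 2 := by
      have : reflDist X Y < δ ^ 2 := hY.trans_le (min_le_left _ _)
      rw [reflDist] at this
      nlinarith [sq_nonneg (Y.2 ^ 2 - X.2 ^ 2)]
    have hq2 : (Y.2 ^ 2 - X.2 ^ 2) ^ 2 < (δ ^ 2) ^ 2 := by
      have : reflDist X Y < δ ^ 4 := hY.trans_le (min_le_right _ _)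
      rw [reflDist] at this
      nlinarith [sq_nonneg ‖X.1 - Y.1‖]
    have hn1 : ‖X.1 - Y.1‖ < δ := lt_of_pow_lt_pow_left₀ 2 hδ.le hq1
    have hn2 : |Y.2 ^ 2 - X.2 ^ 2| < δ ^ 2 := abs_lt_of_sq_lt_sq hq2 (by positivity)
    have hn3 : |Y.2 - X.2| * |Y.2 - -X.2| < δ * δ := by
      rw [← abs_mul, ← sq]
      rwa [show (Y.2 - X.2) * (Y.2 - -X.2) = Y.2 ^ 2 - X.2 ^ 2 by ring]
    by_cases hc : |Y.2 - X.2| < δ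
    · exact H1 Y (hn1.trans_le (min_le_left _ _)) (hc.trans_le (min_le_left _ _))
    · by_cases hc' : |Y.2 - -X.2| < δ
      · exact H2 Y (hn1.trans_le (min_le_right _ _)) (hc'.trans_le (min_le_right _ _))
      · push Not at hc hc'
        exact absurd hn3 (not_lt.2 (mul_le_mul hc hc' hδ.le (abs_nonneg _)))
  refine ⟨M * ((2 + X.2 ^ 2) / η + 1), by positivity, fun Y => ?_⟩
  have hr := reflDist_nonneg X Y
  by_cases hY : reflDist X Y < η
  · exact (near Y hY).le.trans (le_add_of_nonneg_right (by positivity))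
  · push Not at hY
    have hg := growth_le_reflDist X Y
    have h3 : 2 + X.2 ^ 2 ≤ (2 + X.2 ^ 2) / η * reflDist X Y := by
      rw [div_mul_eq_mul_div, le_div_iff₀ hη]
      gcongr
    calc |f Y| ≤ M * (1 + Y.2 ^ 2) := hb Y
      _ ≤ M * ((2 + X.2 ^ 2) / η * reflDist X Y + reflDist X Y) :=
        mul_le_mul_of_nonneg_left (by linarith) hM
      _ = M * ((2 + X.2 ^ 2) / η + 1) * reflDist X Y := by ring
      _ ≤ _ := by linarith

lemma tendsto_integral_kernelDensity_mul (hn : 1 ≤ n) (ha : -1 < a) (ha' : a < 1)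
    {f : Space n → ℝ} (hf : Continuous f) {M : ℝ}
    (hb : ∀ Y, |f Y| ≤ M * (1 + Y.2 ^ 2)) (h1 : f (X.1, X.2) = 0) (h2 : f (X.1, -X.2) = 0) :
    Tendsto (fun s => ∫ Y, kernelDensity n a X s Y * f Y) (𝓝[>] 0) (𝓝 0) := by
  have hK : 0 < 1 + 8 / (1 + a) := by
    have : 0 < 1 + a := by linarith
    positivity
  rw [Metric.tendsto_nhds]
  intro ε hε
  obtain ⟨C, hC, hfC⟩ := exists_le_add_reflDist hf hb h1 h2
    (ε := ε / (2 * (1 + 8 / (1 + a)))) (by positivity)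
  have ht : Tendsto (fun s => (1 + 8 / (1 + a)) *
      (ε / (2 * (1 + 8 / (1 + a))) + C * reflMoment n a X.2 s)) (𝓝[>] 0) (𝓝 (ε / 2)) := by
    have := ((((tendsto_reflMoment n a X.2).const_mul C).const_add
      (ε / (2 * (1 + 8 / (1 + a))))).const_mul (1 + 8 / (1 + a)))
    rwa [mul_zero, add_zero, show (1 + 8 / (1 + a)) * (ε / (2 * (1 + 8 / (1 + a)))) = ε / 2 by
      field_simp] at this
  filter_upwards [ht.eventually_lt_const (show ε / 2 < ε by linarith), self_mem_nhdsWithin]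
    with s hs1 hs0
  rw [Real.dist_eq, sub_zero]
  exact (kernelDensity_mul_bound hn ha ha' hs0 hf.measurable hC hfC).2.trans_lt hs1

lemma abs_oddPower_le (ha : -1 < a) (ha' : a < 1) (y : ℝ) : |oddPower a y| ≤ 1 + y ^ 2 := by
  rcases eq_or_ne y 0 with rfl | hy
  · simp [oddPower_zero]
  rw [abs_oddPower hy]
  rcases le_total |y| 1 with h | h
  · have := Real.rpow_le_one (abs_nonneg y) h (show 0 ≤ 1 - a by linarith)
    nlinarith [sq_nonneg y]
  · have := Real.rpow_le_rpow_of_exponent_le h (show 1 - a ≤ 2 by linarith)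
    rw [Real.rpow_two, sq_abs] at this
    linarith

/-- Multiplying out, the part even in y is α times the density of exponent a plus β h(x) times the
density of exponent 2 - a, because |y|^a h(y)² = |y|^(2-a). The rest is odd in y and integrates to
zero. -/
lemma integral_kernelDensity_mul_affine (hn : 1 ≤ n) (ha : -1 < a) (ha' : a < 1) (hs : 0 < s)
    (α β : ℝ) : ∫ Y, kernelDensity n a X s Y * (α + β * oddPower a Y.2) =
      α + β * oddPower a X.2 := by
  have hm : Measurable fun Y : Space n => α + β * oddPower a Y.2 := by
    have := continuous_oddPower ha'
    fun_prop
  have hi : Integrable (fun Y => kernelDensity n a X s Y * (α + β * oddPower a Y.2)) := by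
    refine integrable_kernelDensity_mul (M := |α| + |β|) hn ha ha' hs hm fun Y => ?_
    have h1 := abs_oddPower_le ha ha' Y.2
    calc |α + β * oddPower a Y.2| ≤ |α| + |β| * |oddPower a Y.2| := by
          rw [← abs_mul]; exact abs_add_le _ _
      _ ≤ |α| * (1 + Y.2 ^ 2) + |β| * (1 + Y.2 ^ 2) := by
        gcongr
        exact le_mul_of_one_le_right (abs_nonneg _) (by nlinarith [sq_nonneg Y.2])
      _ = _ := by ring
  have i12 := integrable_add_integral_eq (evenDensity_const_mul (X := X) hn ha hs hs α)
    (evenDensity_const_mul (X := X) (p := 2 - a) hn (by linarith) hs hs (β * oddPower a X.2))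
  set R : Space n → ℝ := fun Y => heatKernel n (X.1 - Y.1) s *
    ((β * evenKernel a X.2 Y.2 s + α * oddPower a X.2 * evenKernel (2 - a) X.2 Y.2 s) *
      oddPower a Y.2 * |Y.2| ^ a) with hR
  have hdec : ∀ Y, kernelDensity n a X s Y * (α + β * oddPower a Y.2) =
      α * evenDensity n a X s s Y + β * oddPower a X.2 * evenDensity n (2 - a) X s s Y + R Y := by
    intro Y
    have h1 : |Y.2| ^ (2 - a) = |Y.2| ^ a * oddPower a Y.2 * oddPower a Y.2 := by
      rw [rpow_mul_oddPower, mul_oddPower (by linarith)]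
    rw [kernelDensity, kernel1_eq hs, evenDensity, evenDensity, h1]
    simp only [hR]
    ring
  -- The odd part needs no estimate of its own: it is the difference of two integrable functions.
  have iR : Integrable R := by
    refine (hi.sub i12.1).congr (Eventually.of_forall fun Y => ?_)
    simp only [Pi.sub_apply, hdec]
    ring
  have hR0 : ∫ Y, R Y = 0 := by
    rw [Measure.volume_eq_prod, integral_prod _ iR]
    have : ∀ v, ∫ y, R (v, y) = 0 := by
      intro v
      have h1 : ∫ y, R (v, -y) = ∫ y, R (v, y) := integral_neg_eq_self (fun y => R (v, y)) volume
      have h2 : ∀ y, R (v, -y) = -R (v, y) := by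
        intro y
        simp only [hR, evenKernel_neg, oddPower_neg, abs_neg]
        ring
      simp only [h2, integral_neg] at h1
      linarith
    simp [this]
  simp only [hdec]
  rw [integral_add i12.1 iR, i12.2, hR0, add_zero]

/-- Oddness of h separates x from -x. At x = 0 the two points coincide, so the two values must
agree. -/
lemma exists_affine_interpolation (x c d : ℝ) (h0 : x = 0 → c = d) :
    ∃ α β : ℝ, α + β * oddPower a x = c ∧ α + β * oddPower a (-x) = d := by
  rcases eq_or_ne x 0 with rfl | hx
  · exact ⟨c, 0, by simp, by simp [h0 rfl]⟩
  · have h := oddPower_ne_zero (a := a) hx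
    refine ⟨(c + d) / 2, (c - d) / (2 * oddPower a x), ?_, ?_⟩
    · field_simp; ring
    · rw [oddPower_neg]; field_simp; ring

lemma tendsto_integral_kernelDensity (hn : 1 ≤ n) (ha : -1 < a) (ha' : a < 1)
    {g : Space n → ℝ} (hg : Continuous g) {M : ℝ} (hM : ∀ Y, |g Y| ≤ M) (X : Space n) :
    Tendsto (fun s => ∫ Y, kernelDensity n a X s Y * g Y) (𝓝[>] 0) (𝓝 (g X)) := by
  obtain ⟨α, β, h1, h2⟩ := exists_affine_interpolation (a := a) X.2 (g (X.1, X.2)) (g (X.1, -X.2))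
    (fun h => by rw [h, neg_zero])
  have hc := continuous_oddPower ha'
  set f : Space n → ℝ := fun Y => g Y - (α + β * oddPower a Y.2) with hf
  have hfc : Continuous f := by fun_prop
  have hlin : ∀ Y : Space n, |α + β * oddPower a Y.2| ≤ (|α| + |β|) * (1 + Y.2 ^ 2) := by
    intro Y
    have h1 := abs_oddPower_le ha ha' Y.2
    calc |α + β * oddPower a Y.2| ≤ |α| + |β| * |oddPower a Y.2| := by
          rw [← abs_mul]; exact abs_add_le _ _
      _ ≤ |α| * (1 + Y.2 ^ 2) + |β| * (1 + Y.2 ^ 2) := by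
        gcongr
        exact le_mul_of_one_le_right (abs_nonneg _) (by nlinarith [sq_nonneg Y.2])
      _ = _ := by ring
  have hM0 : 0 ≤ M := (abs_nonneg _).trans (hM 0)
  have hfb : ∀ Y, |f Y| ≤ (M + (|α| + |β|)) * (1 + Y.2 ^ 2) := by
    intro Y
    calc |f Y| ≤ |g Y| + |α + β * oddPower a Y.2| := abs_sub _ _
      _ ≤ M * (1 + Y.2 ^ 2) + (|α| + |β|) * (1 + Y.2 ^ 2) := by
        refine add_le_add ((hM Y).trans ?_) (hlin Y)
        exact le_mul_of_one_le_right hM0 (by nlinarith [sq_nonneg Y.2])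
      _ = _ := by ring
  have ht := (tendsto_integral_kernelDensity_mul hn ha ha' hfc hfb
    (by simp only [hf]; rw [h1, sub_self]) (by simp only [hf]; rw [h2, sub_self])).add_const (g X)
  rw [zero_add] at ht
  refine ht.congr' ?_
  filter_upwards [self_mem_nhdsWithin] with s hs
  have hs : 0 < s := hs
  have e : g X = ∫ Y, kernelDensity n a X s Y * (α + β * oddPower a Y.2) := by
    rw [integral_kernelDensity_mul_affine hn ha ha' hs, h1]
  have hm : Measurable fun Y : Space n => α + β * oddPower a Y.2 := by fun_prop
  rw [e, ← integral_add (integrable_kernelDensity_mul hn ha ha' hs hfc.measurable hfb)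
    (integrable_kernelDensity_mul hn ha ha' hs hm hlin)]
  refine integral_congr_ae (Eventually.of_forall fun Y => ?_)
  simp only [hf]
  ring

theorem Γ_initial_trace (hn : 1 ≤ n) (ha : -1 < a) (ha' : a < 1)
    {g : Space n → ℝ} (hg : Continuous g) {M : ℝ} (hM : ∀ Y, |g Y| ≤ M) (X : Space n) (τ : ℝ) :
    (∀ t, τ < t → Integrable (fun Y : Space n => Γ n a X t Y τ * g Y * |Y.2| ^ a)) ∧
      Tendsto (fun t => ∫ Y : Space n, Γ n a X t Y τ * g Y * |Y.2| ^ a)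
        (𝓝[>] τ) (𝓝 (g X)) := by
  have e : ∀ t, τ < t → ∀ Y : Space n, Γ n a X t Y τ * g Y * |Y.2| ^ a =
      kernelDensity n a X (t - τ) Y * g Y := by
    intro t ht Y
    rw [Γ_of_lt ht, kernelDensity]
    ring
  constructor
  · intro t ht
    simp only [e t ht]
    refine integrable_kernelDensity_mul (M := M) hn ha ha' (sub_pos.2 ht) hg.measurable fun Y => ?_
    exact (hM Y).trans (le_mul_of_one_le_right ((abs_nonneg _).trans (hM Y))
      (by nlinarith [sq_nonneg Y.2]))
  · have hshift : Tendsto (fun t => t - τ) (𝓝[>] τ) (𝓝[>] 0) := by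
      refine tendsto_nhdsWithin_iff.2 ⟨?_, ?_⟩
      · have : Continuous fun t : ℝ => t - τ := by fun_prop
        simpa using (this.tendsto τ).mono_left nhdsWithin_le_nhds
      · filter_upwards [self_mem_nhdsWithin] with t ht
        exact sub_pos.2 (mem_Ioi.1 ht)
    refine ((tendsto_integral_kernelDensity hn ha ha' hg hM X).comp hshift).congr' ?_
    filter_upwards [self_mem_nhdsWithin] with t ht
    simp only [Function.comp, e t ht]

end

end DegenerateHeat

/-! ### The one-dimensional equation and the flux across y = 0. -/

namespace DegenerateHeat

noncomputable section

/-- The quotient `(∂_y evenKernel) / y`. -/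
def evenSlope (p x y s : ℝ) : ℝ :=
  (x ^ 2 * evenKernel (p + 2) x y s - evenKernel p x y s) / (2 * s)

/-- The time derivative of `evenKernel`. -/
def evenRate (p x y s : ℝ) : ℝ :=
  (-(p + 1) / (2 * s) + (x ^ 2 + y ^ 2) / (4 * s ^ 2)) * evenKernel p x y s -
    x ^ 2 * y ^ 2 / (2 * s ^ 2) * evenKernel (p + 2) x y s

variable {a p x y s : ℝ}

lemma hasDerivAt_evenSlope (hp : -1 < p) (hs : 0 < s) :
    HasDerivAt (fun y => evenSlope p x y s)
      (y * ((x ^ 2 * evenSlope (p + 2) x y s - evenSlope p x y s) / (2 * s))) y := by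
  have h1 := (hasDerivAt_evenKernel_space (p := p + 2) (x := x) (y := y) (by linarith) hs).const_mul
    (x ^ 2)
  have h2 := hasDerivAt_evenKernel_space (p := p) (x := x) (y := y) hp hs
  refine ((h1.sub h2).div_const (2 * s)).congr_deriv ?_
  simp only [evenSlope]
  ring

/-- With S = `evenSlope` one has ∂_y E = y S, so the right side is ∂_y² E + (p/y) ∂_y E written
without division by y. This is the heat equation for E. -/
lemma evenRate_eq (hp : -1 < p) (hs : 0 < s) :
    evenRate p x y s = (1 + p) * evenSlope p x y s +
      y ^ 2 * ((x ^ 2 * evenSlope (p + 2) x y s - evenSlope p x y s) / (2 * s)) := by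
  have h := evenKernel_recurrence (x := x) (y := y) hp hs
  have h1 : x ^ 2 * y ^ 2 * evenKernel (p + 4) x y s =
      evenKernel p x y s - 2 * s * (p + 1) * evenKernel (p + 2) x y s := by linarith
  have h2 : (1 + p) * evenSlope p x y s +
      y ^ 2 * ((x ^ 2 * evenSlope (p + 2) x y s - evenSlope p x y s) / (2 * s)) =
      (1 + p) * ((x ^ 2 * evenKernel (p + 2) x y s - evenKernel p x y s) / (2 * s)) +
      (x ^ 2 * (x ^ 2 * y ^ 2 * evenKernel (p + 4) x y s) -
        2 * x ^ 2 * y ^ 2 * evenKernel (p + 2) x y s + y ^ 2 * evenKernel p x y s) /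
        (4 * s ^ 2) := by
    simp only [evenSlope, show p + 2 + 2 = p + 4 by ring]
    field_simp
    ring
  rw [h2, h1, evenRate]
  field_simp
  ring

/-- The part of `∂_y kernel1` which is continuous across `y = 0`. -/
def kernelDerivReg (a x y s : ℝ) : ℝ :=
  y * (evenSlope a x y s + oddPower a x * oddPower a y * evenSlope (2 - a) x y s)

/-- The coefficient of `|y| ^ (-a)` in `∂_y kernel1`. -/
def kernelDerivSing (a x y s : ℝ) : ℝ :=
  (1 - a) * oddPower a x * evenKernel (2 - a) x y s

/-- The time derivative of `kernel1`. -/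
def kernelRate (a x y s : ℝ) : ℝ :=
  evenRate a x y s + oddPower a x * oddPower a y * evenRate (2 - a) x y s

/-- The flux `|y| ^ a ∂_y kernel1`. -/
def kernelFlux (a x y s : ℝ) : ℝ :=
  oddPower (-a) y * evenSlope a x y s +
    oddPower a x * (y ^ 2 * evenSlope (2 - a) x y s + (1 - a) * evenKernel (2 - a) x y s)

lemma hasDerivAt_kernel1_space (ha : -1 < a) (ha' : a < 1) (hs : 0 < s) (hy : y ≠ 0) :
    HasDerivAt (fun y => kernel1 a x y s)
      (kernelDerivReg a x y s + |y| ^ (-a) * kernelDerivSing a x y s) y := by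
  have h1 := hasDerivAt_evenKernel_space (x := x) (y := y) ha hs
  have h2 := hasDerivAt_evenKernel_space (p := 2 - a) (x := x) (y := y) (by linarith) hs
  have h3 := (hasDerivAt_oddPower (a := a) hy).const_mul (oddPower a x)
  have e : (fun y => kernel1 a x y s) = fun y =>
      evenKernel a x y s + oddPower a x * oddPower a y * evenKernel (2 - a) x y s := by
    funext y
    exact kernel1_eq hs
  rw [e]
  refine (h1.add (h3.mul h2)).congr_deriv ?_
  simp only [kernelDerivReg, kernelDerivSing, evenSlope]
  ring

lemma hasDerivAt_kernel1_time (ha : -1 < a) (ha' : a < 1) (hs : 0 < s) :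
    HasDerivAt (fun s => kernel1 a x y s) (kernelRate a x y s) s := by
  have h1 := hasDerivAt_evenKernel_time (x := x) (y := y) ha hs
  have h2 := hasDerivAt_evenKernel_time (p := 2 - a) (x := x) (y := y) (by linarith) hs
  refine (h1.add (h2.const_mul (oddPower a x * oddPower a y))).congr_of_eventuallyEq ?_
  filter_upwards [lt_mem_nhds hs] with r hr
  exact kernel1_eq hr

/-- The weight cancels the singular factor |y|^(-a), which is why `kernelFlux` can be given by an
expression continuous at y = 0. -/
lemma rpow_mul_kernelDeriv (hy : y ≠ 0) :
    |y| ^ a * (kernelDerivReg a x y s + |y| ^ (-a) * kernelDerivSing a x y s) =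
      kernelFlux a x y s := by
  have h1 : |y| ^ a * |y| ^ (-a) = 1 := by
    rw [← Real.rpow_add (abs_pos.2 hy), add_neg_cancel, Real.rpow_zero]
  have h2 : |y| ^ a * oddPower a y = y := rpow_mul_oddPower
  have h3 : oddPower (-a) y = y * |y| ^ a := by rw [oddPower, neg_neg]
  simp only [kernelFlux, kernelDerivReg, kernelDerivSing, h3]
  linear_combination ((1 - a) * oddPower a x * evenKernel (2 - a) x y s) * h1 +
    (y * oddPower a x * evenSlope (2 - a) x y s) * h2

/-- The even part uses the heat equation with exponent a, the odd part the one with exponent 2 - a: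
since |y|^a h(y) = y, differentiating y² S + (1 - a) E gives y times the rate of E. -/
lemma hasDerivAt_kernelFlux (ha : -1 < a) (ha' : a < 1) (hs : 0 < s) (hy : y ≠ 0) :
    HasDerivAt (fun y => kernelFlux a x y s) (|y| ^ a * kernelRate a x y s) y := by
  have hp : -1 < 2 - a := by linarith
  have h1 := (hasDerivAt_oddPower (a := -a) hy).mul (hasDerivAt_evenSlope (x := x) (y := y) ha hs)
  have h2 := (hasDerivAt_pow 2 y).mul (hasDerivAt_evenSlope (x := x) (y := y) hp hs)
  have h3 := (hasDerivAt_evenKernel_space (x := x) (y := y) hp hs).const_mul (1 - a)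
  refine (h1.add ((h2.add h3).const_mul (oddPower a x))).congr_deriv ?_
  have h4 : |y| ^ a * oddPower a y = y := rpow_mul_oddPower
  have h5 : oddPower (-a) y = y * |y| ^ a := by rw [oddPower, neg_neg]
  have h6 := evenRate_eq (x := x) (y := y) ha hs
  have h7 := evenRate_eq (x := x) (y := y) hp hs
  have h8 : (x ^ 2 * evenKernel (2 - a + 2) x y s - evenKernel (2 - a) x y s) / (2 * s) =
      evenSlope (2 - a) x y s := rfl
  rw [kernelRate, h6, h7, h8, neg_neg, h5]
  linear_combination (-(oddPower a x * ((3 - a) * evenSlope (2 - a) x y s +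
    y ^ 2 * ((x ^ 2 * evenSlope (2 - a + 2) x y s - evenSlope (2 - a) x y s) / (2 * s))))) * h4

lemma continuousOn_evenKernel (hp : -1 < p) (x : ℝ) :
    ContinuousOn (fun q : ℝ × ℝ => evenKernel p x q.1 q.2) {q | 0 < q.2} :=
  fun _ hq => (differentiableAt_evenKernel hp x hq).continuousAt.continuousWithinAt

lemma continuousOn_evenSlope (hp : -1 < p) (x : ℝ) :
    ContinuousOn (fun q : ℝ × ℝ => evenSlope p x q.1 q.2) {q | 0 < q.2} := by
  have h1 := continuousOn_evenKernel hp x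
  have h2 := continuousOn_evenKernel (p := p + 2) (by linarith) x
  unfold evenSlope
  refine ((continuousOn_const.mul h2).sub h1).div (by fun_prop) fun q hq => ?_
  have : 0 < q.2 := hq
  positivity

lemma continuousOn_evenRate (hp : -1 < p) (x : ℝ) :
    ContinuousOn (fun q : ℝ × ℝ => evenRate p x q.1 q.2) {q | 0 < q.2} := by
  have h1 := continuousOn_evenKernel hp x
  have h2 := continuousOn_evenKernel (p := p + 2) (by linarith) x
  have h0 : ∀ q ∈ {q : ℝ × ℝ | 0 < q.2}, q.2 ≠ 0 := fun q hq => ne_of_gt hq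
  unfold evenRate
  refine ContinuousOn.sub (ContinuousOn.mul (ContinuousOn.add ?_ ?_) h1) (ContinuousOn.mul ?_ h2)
  all_goals
    refine ContinuousOn.div (by fun_prop) (by fun_prop) fun q hq => ?_
    have := h0 q hq
    positivity

lemma continuousOn_kernel1 (ha : -1 < a) (ha' : a < 1) (x : ℝ) :
    ContinuousOn (fun q : ℝ × ℝ => kernel1 a x q.1 q.2) {q | 0 < q.2} := by
  have h1 := continuousOn_evenKernel ha x
  have h2 := continuousOn_evenKernel (p := 2 - a) (by linarith) x
  have h3 : Continuous fun q : ℝ × ℝ => oddPower a q.1 :=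
    (continuous_oddPower ha').comp continuous_fst
  exact (h1.add ((continuousOn_const.mul h3.continuousOn).mul h2)).congr fun q hq => kernel1_eq hq

lemma continuousOn_kernelDerivReg (ha : -1 < a) (ha' : a < 1) (x : ℝ) :
    ContinuousOn (fun q : ℝ × ℝ => kernelDerivReg a x q.1 q.2) {q | 0 < q.2} := by
  have h1 := continuousOn_evenSlope ha x
  have h2 := continuousOn_evenSlope (p := 2 - a) (by linarith) x
  have h3 : Continuous fun q : ℝ × ℝ => oddPower a q.1 :=
    (continuous_oddPower ha').comp continuous_fst
  exact continuousOn_fst.mul (h1.add ((continuousOn_const.mul h3.continuousOn).mul h2))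

lemma continuousOn_kernelDerivSing (ha' : a < 1) (x : ℝ) :
    ContinuousOn (fun q : ℝ × ℝ => kernelDerivSing a x q.1 q.2) {q | 0 < q.2} :=
  continuousOn_const.mul (continuousOn_evenKernel (p := 2 - a) (by linarith) x)

lemma continuousOn_kernelRate (ha : -1 < a) (ha' : a < 1) (x : ℝ) :
    ContinuousOn (fun q : ℝ × ℝ => kernelRate a x q.1 q.2) {q | 0 < q.2} := by
  have h1 := continuousOn_evenRate ha x
  have h2 := continuousOn_evenRate (p := 2 - a) (by linarith) x
  have h3 : Continuous fun q : ℝ × ℝ => oddPower a q.1 :=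
    (continuous_oddPower ha').comp continuous_fst
  exact h1.add ((continuousOn_const.mul h3.continuousOn).mul h2)

lemma continuousOn_kernelFlux (ha : -1 < a) (ha' : a < 1) (x : ℝ) :
    ContinuousOn (fun q : ℝ × ℝ => kernelFlux a x q.1 q.2) {q | 0 < q.2} := by
  have h1 := continuousOn_evenSlope ha x
  have h2 := continuousOn_evenSlope (p := 2 - a) (by linarith) x
  have h4 := continuousOn_evenKernel (p := 2 - a) (by linarith) x
  have h3 : Continuous fun q : ℝ × ℝ => oddPower (-a) q.1 :=
    (continuous_oddPower (by linarith)).comp continuous_fst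
  exact (h3.continuousOn.mul h1).add (continuousOn_const.mul
    (((continuousOn_fst.pow 2).mul h2).add (continuousOn_const.mul h4)))

lemma differentiableAt_kernel1 (ha : -1 < a) (ha' : a < 1) (x : ℝ) {q : ℝ × ℝ} (hq : 0 < q.2)
    (hy : q.1 ≠ 0) : DifferentiableAt ℝ (fun q : ℝ × ℝ => kernel1 a x q.1 q.2) q := by
  have h1 := differentiableAt_evenKernel ha x hq
  have h2 := differentiableAt_evenKernel (p := 2 - a) (by linarith) x hq
  have h3 : DifferentiableAt ℝ (fun q : ℝ × ℝ => oddPower a q.1) q :=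
    (hasDerivAt_oddPower hy).differentiableAt.comp q differentiableAt_fst
  have h4 : DifferentiableAt ℝ (fun q : ℝ × ℝ => evenKernel a x q.1 q.2 +
      oddPower a x * oddPower a q.1 * evenKernel (2 - a) x q.1 q.2) q :=
    h1.add ((h3.const_mul _).mul h2)
  refine h4.congr_of_eventuallyEq ?_
  filter_upwards [continuous_snd.continuousAt.eventually (lt_mem_nhds hq)] with r hr
  exact kernel1_eq hr

end

end DegenerateHeat

/-! ### Weighted integrability and integration by parts in space-time. -/

namespace DegenerateHeat

noncomputable section

variable {n : ℕ}

instance isAddHaarMeasure_volume_spaceTime :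
    (volume : Measure (Space n × ℝ)).IsAddHaarMeasure := by
  have h : (volume : Measure (Space n)).IsAddHaarMeasure :=
    inferInstanceAs (Measure.prod volume volume).IsAddHaarMeasure
  exact inferInstanceAs (Measure.prod (volume : Measure (Space n)) volume).IsAddHaarMeasure

lemma locallyIntegrable_abs_rpow_real {α : ℝ} (hα : -1 < α) :
    LocallyIntegrable fun y : ℝ => |y| ^ α := by
  refine locallyIntegrable_of_norm_le_rpow (C := 1) (α := -α) (by simp) (by simp; linarith)
    (Eventually.of_forall fun y => ?_) ?_
  · rw [Real.norm_eq_abs, abs_of_nonneg (by positivity), neg_neg, one_mul, Real.norm_eq_abs]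
  · exact (measurable_norm.pow_const α).aestronglyMeasurable

lemma locallyIntegrable_abs_rpow {α : ℝ} (hα : -1 < α) :
    LocallyIntegrable fun p : Space n × ℝ => |p.1.2| ^ α := by
  rw [locallyIntegrable_iff]
  intro K hK
  set A := (fun p : Space n × ℝ => p.1.1) '' K
  set B := (fun p : Space n × ℝ => p.1.2) '' K
  set C := (fun p : Space n × ℝ => p.2) '' K
  have hA : IsCompact A := hK.image (by fun_prop)
  have hB : IsCompact B := hK.image (by fun_prop)
  have hC : IsCompact C := hK.image (by fun_prop)
  have hsub : K ⊆ (A ×ˢ B) ×ˢ C := fun p hp =>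
    ⟨⟨mem_image_of_mem _ hp, mem_image_of_mem _ hp⟩, mem_image_of_mem _ hp⟩
  refine IntegrableOn.mono_set ?_ hsub
  have h1 : IntegrableOn (fun y : ℝ => |y| ^ α) B :=
    (locallyIntegrable_abs_rpow_real hα).integrableOn_isCompact hB
  have : IsFiniteMeasure (volume.restrict A) := ⟨by simpa using hA.measure_lt_top⟩
  have : IsFiniteMeasure (volume.restrict C) := ⟨by simpa using hC.measure_lt_top⟩
  rw [IntegrableOn, Measure.volume_eq_prod, ← Measure.prod_restrict, Measure.volume_eq_prod,
    ← Measure.prod_restrict]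
  exact (Integrable.comp_snd (f := fun y : ℝ => |y| ^ α) h1 (volume.restrict A)).comp_fst
    (volume.restrict C)

/-- Vanishing outside a compact subset of U turns continuity on U into global continuity with
compact support, which may then be paired with a locally integrable weight. -/
lemma integrable_abs_rpow_smul {F : Type*} [NormedAddCommGroup F] [NormedSpace ℝ F] {α : ℝ}
    (hα : -1 < α) {U K : Set (Space n × ℝ)} (hU : IsOpen U) (hK : IsCompact K) (hKU : K ⊆ U)
    {R : Space n × ℝ → F} (hR : ContinuousOn R U) (hR0 : ∀ p, p ∉ K → R p = 0) :
    Integrable fun p => |p.1.2| ^ α • R p := by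
  have hts : tsupport R ⊆ K := closure_minimal (fun p hp => by
    by_contra h
    exact hp (hR0 p h)) hK.isClosed
  exact (locallyIntegrable_abs_rpow hα).integrable_smul_right_of_hasCompactSupport
    (hR.continuous_of_tsupport_subset hU (hts.trans hKU))
    (hK.of_isClosed_subset (isClosed_tsupport R) hts)

lemma integrable_of_continuousOn {F : Type*} [NormedAddCommGroup F] [NormedSpace ℝ F]
    {U K : Set (Space n × ℝ)} (hU : IsOpen U) (hK : IsCompact K) (hKU : K ⊆ U)
    {R : Space n × ℝ → F} (hR : ContinuousOn R U) (hR0 : ∀ p, p ∉ K → R p = 0) :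
    Integrable R := by
  simpa using integrable_abs_rpow_smul (α := 0) (by norm_num) hU hK hKU hR hR0

lemma ae_ne_zero : ∀ᵐ p : Space n × ℝ, p.1.2 ≠ 0 := by
  have h0 : ∀ᵐ y : ℝ, y ≠ 0 := by simp [ae_iff, measure_singleton]
  have h1 : ∀ᵐ Y : Space n, Y.2 ≠ 0 := by
    rw [Measure.volume_eq_prod]
    exact Measure.quasiMeasurePreserving_snd.ae h0
  rw [Measure.volume_eq_prod]
  exact Measure.quasiMeasurePreserving_fst.ae h1

/-- The fundamental theorem of calculus holds on each half-line, with limits zero at ±∞ because f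
and f' are integrable. Continuity at 0 makes the two boundary values cancel. -/
lemma integral_deriv_eq_zero_real {f f' : ℝ → ℝ} (hf : Continuous f)
    (hd : ∀ y, y ≠ 0 → HasDerivAt f (f' y) y) (hi : Integrable f) (hi' : Integrable f') :
    ∫ y, f' y = 0 := by
  have h1 := integral_Ioi_of_hasDerivAt_of_tendsto (a := 0) hf.continuousWithinAt
    (fun y hy => hd y (ne_of_gt hy)) hi'.integrableOn
    (tendsto_zero_of_hasDerivAt_of_integrableOn_Ioi (fun y hy => hd y (ne_of_gt hy))
      hi'.integrableOn hi.integrableOn)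
  have h2 := integral_Iic_of_hasDerivAt_of_tendsto (a := 0) hf.continuousWithinAt
    (fun y hy => hd y (ne_of_lt hy)) hi'.integrableOn
    -- The half-line up to -1 is taken because the one up to 0 contains the point where no
    -- derivative is assumed.
    (tendsto_zero_of_hasDerivAt_of_integrableOn_Iic (a := -1)
      (fun y hy => hd y (ne_of_lt (lt_of_le_of_lt hy (by norm_num))))
      hi'.integrableOn hi.integrableOn)
  rw [← intervalIntegral.integral_Iic_add_Ioi hi'.integrableOn hi'.integrableOn, h1, h2]
  ring

lemma integral_deriv_snd_eq_zero {f f' : Space n × ℝ → ℝ} (hf : Continuous f)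
    (hd : ∀ p : Space n × ℝ, p.1.2 ≠ 0 →
      HasDerivAt (fun y => f ((p.1.1, y), p.2)) (f' p) p.1.2)
    (hi : Integrable f) (hi' : Integrable f') : ∫ p, f' p = 0 := by
  rw [Measure.volume_eq_prod] at hi hi' ⊢
  rw [integral_prod_symm _ hi']
  refine integral_eq_zero_of_ae ?_
  filter_upwards [hi.prod_left_ae, hi'.prod_left_ae] with τ h1 h1'
  rw [Measure.volume_eq_prod] at h1 h1' ⊢
  rw [integral_prod _ h1']
  refine integral_eq_zero_of_ae ?_
  filter_upwards [h1.prod_right_ae, h1'.prod_right_ae] with v h2 h2'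
  exact integral_deriv_eq_zero_real (f := fun y => f ((v, y), τ)) (hf.comp (by fun_prop))
    (fun y hy => hd ((v, y), τ) hy) h2 h2'

lemma hasDerivAt_snd_of_differentiable {φ : Space n × ℝ → ℝ} (hφ : Differentiable ℝ φ)
    (p : Space n × ℝ) :
    HasDerivAt (fun y => φ ((p.1.1, y), p.2)) (fderiv ℝ φ p ((0, 1), 0)) p.1.2 := by
  have h1 : HasDerivAt (fun y : ℝ => (((p.1.1, y), p.2) : Space n × ℝ)) ((0, 1), 0) p.1.2 :=
    ((hasDerivAt_const _ _).prodMk (hasDerivAt_id _)).prodMk (hasDerivAt_const _ _)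
  exact (hφ p).hasFDerivAt.comp_hasDerivAt p.1.2 h1

lemma hasDerivAt_time_of_differentiable {φ : Space n × ℝ → ℝ} (hφ : Differentiable ℝ φ)
    (p : Space n × ℝ) :
    HasDerivAt (fun τ => φ (p.1, τ)) (fderiv ℝ φ p (0, 1)) p.2 := by
  have h1 : HasDerivAt (fun τ : ℝ => ((p.1, τ) : Space n × ℝ)) (0, 1) p.2 :=
    (hasDerivAt_const _ _).prodMk (hasDerivAt_id _)
  exact (hφ p).hasFDerivAt.comp_hasDerivAt p.2 h1

lemma hasGradientAt_fst_of_differentiable {φ : Space n × ℝ → ℝ} (hφ : Differentiable ℝ φ)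
    (p : Space n × ℝ) :
    HasGradientAt (fun v => φ ((v, p.1.2), p.2))
      ((InnerProductSpace.toDual ℝ (EuclideanSpace ℝ (Fin (n - 1)))).symm
        ((fderiv ℝ φ p).comp ((ContinuousLinearMap.inl ℝ (Space n) ℝ).comp
          (ContinuousLinearMap.inl ℝ (EuclideanSpace ℝ (Fin (n - 1))) ℝ)))) p.1.1 := by
  rw [hasGradientAt_iff_hasFDerivAt, LinearIsometryEquiv.apply_symm_apply]
  have h1 : HasFDerivAt
      (fun v : EuclideanSpace ℝ (Fin (n - 1)) => (((v, p.1.2), p.2) : Space n × ℝ))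
      ((ContinuousLinearMap.inl ℝ (Space n) ℝ).comp
          (ContinuousLinearMap.inl ℝ (EuclideanSpace ℝ (Fin (n - 1))) ℝ)) p.1.1 := by
    refine (((hasFDerivAt_id p.1.1).prodMk (hasFDerivAt_const p.1.2 p.1.1)).prodMk
      (hasFDerivAt_const p.2 p.1.1)).congr_fderiv ?_
    ext <;> simp
  exact (hφ p).hasFDerivAt.comp p.1.1 h1

lemma spatialGrad_eq {φ : Space n × ℝ → ℝ} (hφ : Differentiable ℝ φ) (p : Space n × ℝ) :
    spatialGrad φ p = ((InnerProductSpace.toDual ℝ (EuclideanSpace ℝ (Fin (n - 1)))).symm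
      ((fderiv ℝ φ p).comp ((ContinuousLinearMap.inl ℝ (Space n) ℝ).comp
        (ContinuousLinearMap.inl ℝ (EuclideanSpace ℝ (Fin (n - 1))) ℝ))),
      fderiv ℝ φ p ((0, 1), 0)) := by
  rw [spatialGrad, (hasGradientAt_fst_of_differentiable hφ p).gradient,
    (hasDerivAt_snd_of_differentiable hφ p).deriv]

lemma inner_spatialGrad_fst {φ : Space n × ℝ → ℝ} (hφ : Differentiable ℝ φ) (p : Space n × ℝ)
    (w : EuclideanSpace ℝ (Fin (n - 1))) :
    inner ℝ w (spatialGrad φ p).1 = fderiv ℝ φ p ((w, 0), 0) := by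
  rw [spatialGrad_eq hφ, real_inner_comm, InnerProductSpace.toDual_symm_apply]
  rfl

lemma spatialGrad_snd {φ : Space n × ℝ → ℝ} (hφ : Differentiable ℝ φ) (p : Space n × ℝ) :
    (spatialGrad φ p).2 = fderiv ℝ φ p ((0, 1), 0) := by
  rw [spatialGrad_eq hφ]

lemma timeDeriv_eq {φ : Space n × ℝ → ℝ} (hφ : Differentiable ℝ φ) (p : Space n × ℝ) :
    timeDeriv φ p = fderiv ℝ φ p (0, 1) :=
  (hasDerivAt_time_of_differentiable hφ p).deriv

lemma continuous_spatialGrad {φ : Space n × ℝ → ℝ} (hφ : ContDiff ℝ 1 φ) :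
    Continuous (spatialGrad φ) := by
  have h : spatialGrad φ = _ := funext (spatialGrad_eq (hφ.differentiable one_ne_zero))
  rw [h]
  have h1 := hφ.continuous_fderiv one_ne_zero
  refine Continuous.prodMk ?_ (h1.clm_apply continuous_const)
  exact (LinearIsometryEquiv.continuous _).comp (h1.clm_comp continuous_const)

lemma fderiv_eq_zero_of_notMem_tsupport {φ : Space n × ℝ → ℝ} {p : Space n × ℝ}
    (hp : p ∉ tsupport φ) : fderiv ℝ φ p = 0 :=
  image_eq_zero_of_notMem_tsupport fun h => hp (tsupport_fderiv_subset ℝ h)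

lemma spatialGrad_eq_zero_of_notMem_tsupport {φ : Space n × ℝ → ℝ} (hφ : Differentiable ℝ φ)
    {p : Space n × ℝ} (hp : p ∉ tsupport φ) : spatialGrad φ p = 0 := by
  rw [spatialGrad_eq hφ, fderiv_eq_zero_of_notMem_tsupport hp]
  simp

lemma integral_mul_fderiv_eq_neg {g g' φ : Space n × ℝ → ℝ} (hφ : Differentiable ℝ φ)
    (v : Space n × ℝ) (hd : ∀ p ∈ tsupport φ, HasLineDerivAt ℝ g (g' p) p v)
    (h1 : Integrable fun p => g p * fderiv ℝ φ p v) (h2 : Integrable fun p => g' p * φ p)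
    (h3 : Integrable fun p => g p * φ p) :
    ∫ p, g p * fderiv ℝ φ p v = -∫ p, g' p * φ p :=
  integral_bilinear_hasLineDerivAt_right_eq_neg_left_of_integrable
    (B := ContinuousLinearMap.mul ℝ ℝ) h2 h1 h3 hd
    fun p _ => (hφ p).hasFDerivAt.hasLineDerivAt v

/-- The y-direction is treated separately since g is only continuous across y = 0; this suffices for
the product g φ to have no jump there. -/
lemma integral_mul_fderiv_snd_eq_neg {g g' φ : Space n × ℝ → ℝ} {U : Set (Space n × ℝ)}
    (hU : IsOpen U) (hφ : IsTest U φ) (hg : ContinuousOn g U)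
    (hd : ∀ p ∈ U, p.1.2 ≠ 0 → HasDerivAt (fun y => g ((p.1.1, y), p.2)) (g' p) p.1.2)
    (h2 : Integrable fun p => g' p * φ p) :
    (Integrable fun p => g p * fderiv ℝ φ p ((0, 1), 0)) ∧
      ∫ p, g p * fderiv ℝ φ p ((0, 1), 0) = -∫ p, g' p * φ p := by
  obtain ⟨hφ1, hφc, hφU⟩ := hφ
  have hφd := hφ1.differentiable one_ne_zero
  have hφ' := hφ1.continuous_fderiv one_ne_zero
  have h1 : Integrable fun p => g p * fderiv ℝ φ p ((0, 1), 0) :=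
    integrable_of_continuousOn hU hφc hφU
      (hg.mul (hφ'.clm_apply continuous_const).continuousOn) fun p hp => by
        simp [fderiv_eq_zero_of_notMem_tsupport hp]
  have h0 : ∀ p, p ∉ tsupport φ → g p * φ p = 0 := fun p hp => by
    rw [image_eq_zero_of_notMem_tsupport hp, mul_zero]
  have hc : ContinuousOn (fun p => g p * φ p) U := hg.mul hφ1.continuous.continuousOn
  have h3 : Integrable fun p => g p * φ p := integrable_of_continuousOn hU hφc hφU hc h0
  have hts : tsupport (fun p => g p * φ p) ⊆ U :=
    (closure_minimal (fun p hp => by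
      by_contra h
      exact hp (h0 p h)) (isClosed_tsupport φ)).trans hφU
  have hcont := hc.continuous_of_tsupport_subset hU hts
  have h4 := integral_deriv_snd_eq_zero (f := fun p => g p * φ p)
    (f' := fun p => g' p * φ p + g p * fderiv ℝ φ p ((0, 1), 0)) hcont (fun p hp => by
      by_cases hpt : p ∈ tsupport φ
      · exact (hd p (hφU hpt) hp).mul (hasDerivAt_snd_of_differentiable hφd p)
      -- Off the support nothing is known about g, but the product vanishes along y in a
      -- neighbourhood.
      · have hz : (fun y => g ((p.1.1, y), p.2) * φ ((p.1.1, y), p.2)) =ᶠ[𝓝 p.1.2]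
            fun _ => 0 := by
          have hcy : Continuous fun y : ℝ => (((p.1.1, y), p.2) : Space n × ℝ) := by fun_prop
          have ho : ∀ᶠ q in 𝓝 p, q ∉ tsupport φ :=
            (isClosed_tsupport φ).isOpen_compl.mem_nhds hpt
          filter_upwards [(hcy.continuousAt (x := p.1.2)).eventually ho] with y hy
          exact h0 _ hy
        rw [image_eq_zero_of_notMem_tsupport hpt, fderiv_eq_zero_of_notMem_tsupport hpt]
        simpa using (hasDerivAt_const p.1.2 (0 : ℝ)).congr_of_eventuallyEq hz) h3 (h2.add h1)
  rw [integral_add h2 h1] at h4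
  exact ⟨h1, by linarith⟩

lemma hasLineDerivAt_fst {g : Space n × ℝ → ℝ} {p : Space n × ℝ}
    {L : EuclideanSpace ℝ (Fin (n - 1)) →L[ℝ] ℝ}
    (h : HasFDerivAt (fun v => g ((v, p.1.2), p.2)) L p.1.1)
    (w : EuclideanSpace ℝ (Fin (n - 1))) : HasLineDerivAt ℝ g (L w) p ((w, 0), 0) := by
  have h1 := h.hasLineDerivAt w
  rw [HasLineDerivAt] at h1 ⊢
  refine h1.congr_of_eventuallyEq (Eventually.of_forall fun r => ?_)
  simp [Prod.add_def, Prod.smul_def]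

lemma hasLineDerivAt_time {g : Space n × ℝ → ℝ} {p : Space n × ℝ} {d : ℝ}
    (h : HasDerivAt (fun τ => g (p.1, τ)) d p.2) : HasLineDerivAt ℝ g d p (0, 1) := by
  have h1 := h.hasFDerivAt.hasLineDerivAt 1
  rw [HasLineDerivAt] at h1 ⊢
  have h2 := h1.congr_of_eventuallyEq (f₁ := fun r : ℝ => g (p + r • (0, 1)))
    (Eventually.of_forall fun r => by simp [Prod.add_def, Prod.smul_def])
  simpa using h2

end

end DegenerateHeat

/-! ### The gradient of the kernel and local energy bounds. -/

namespace DegenerateHeat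

noncomputable section

variable {n : ℕ} {a s : ℝ}

lemma hasGradientAt_heatKernel_sub (x v : EuclideanSpace ℝ (Fin (n - 1))) :
    HasGradientAt (fun v => heatKernel n (x - v) s)
      ((heatKernel n (x - v) s / (2 * s)) • (x - v)) v := by
  rw [hasGradientAt_iff_hasFDerivAt]
  have h1 : HasFDerivAt (fun v : EuclideanSpace ℝ (Fin (n - 1)) => x - v)
      (-ContinuousLinearMap.id ℝ _) v := (hasFDerivAt_id v).const_sub x
  have h2 := ((h1.norm_sq.neg.mul_const (4 * s)⁻¹).exp).const_mul
    ((4 * Real.pi * s) ^ (-((n : ℝ) - 1) / 2))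
  have e : (fun v => heatKernel n (x - v) s) = fun v =>
      (4 * Real.pi * s) ^ (-((n : ℝ) - 1) / 2) * Real.exp (-‖x - v‖ ^ 2 * (4 * s)⁻¹) := by
    funext v
    rw [heatKernel, div_eq_mul_inv (-‖x - v‖ ^ 2)]
  rw [e]
  refine h2.congr_fderiv ?_
  ext w
  simp [heatKernel, div_eq_mul_inv]
  ring

lemma hasDerivAt_heatKernel_time (v : EuclideanSpace ℝ (Fin (n - 1))) (hs : 0 < s) :
    HasDerivAt (fun s => heatKernel n v s)
      (heatKernel n v s * (-((n : ℝ) - 1) / (2 * s) + ‖v‖ ^ 2 / (4 * s ^ 2))) s := by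
  have h4 : 0 < 4 * s := by linarith
  have hpi := Real.pi_pos
  have h4p : 4 * Real.pi * s ≠ 0 := by positivity
  have h0 : HasDerivAt (fun s : ℝ => (4 * Real.pi * s) ^ (-((n : ℝ) - 1) / 2))
      ((4 * Real.pi * s) ^ (-((n : ℝ) - 1) / 2) * (-((n : ℝ) - 1) / (2 * s))) s := by
    have h := (((hasDerivAt_id s).const_mul (4 * Real.pi)).rpow_const
      (p := -((n : ℝ) - 1) / 2) (Or.inl h4p))
    refine h.congr_deriv ?_
    simp only [id, mul_one]
    rw [Real.rpow_sub_one h4p]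
    field_simp
  have h1 : HasDerivAt (fun s : ℝ => -‖v‖ ^ 2 / (4 * s)) (‖v‖ ^ 2 / (4 * s ^ 2)) s := by
    have h4s : HasDerivAt (fun s : ℝ => 4 * s) 4 s := by
      simpa using (hasDerivAt_id s).const_mul 4
    refine ((hasDerivAt_const s (-‖v‖ ^ 2)).div h4s h4.ne').congr_deriv ?_
    field_simp
    ring
  refine (h0.mul h1.exp).congr_deriv ?_
  rw [heatKernel]
  ring

lemma differentiableAt_heatKernel {q : EuclideanSpace ℝ (Fin (n - 1)) × ℝ} (hq : 0 < q.2) :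
    DifferentiableAt ℝ (fun q : EuclideanSpace ℝ (Fin (n - 1)) × ℝ => heatKernel n q.1 q.2) q := by
  have h4 : 4 * q.2 ≠ 0 := by positivity
  have h5 : 4 * Real.pi * q.2 ≠ 0 := by have := Real.pi_pos; positivity
  have h1 : DifferentiableAt ℝ (fun q : EuclideanSpace ℝ (Fin (n - 1)) × ℝ =>
      (4 * Real.pi * q.2) ^ (-((n : ℝ) - 1) / 2)) q :=
    (differentiableAt_snd.const_mul _).rpow_const (Or.inl h5)
  have h3 : DifferentiableAt ℝ (fun q : EuclideanSpace ℝ (Fin (n - 1)) × ℝ => ‖q.1‖ ^ 2) q :=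
    differentiableAt_fst.norm_sq ℝ
  have h2 : DifferentiableAt ℝ (fun q : EuclideanSpace ℝ (Fin (n - 1)) × ℝ =>
      Real.exp (-‖q.1‖ ^ 2 / (4 * q.2))) q :=
    by
    fun_prop (disch := exact h4)
  exact h1.mul h2

/-- The tangential factor of the kernel as a function of `(Y, τ)`. -/
def heatFactor (X : Space n) (t : ℝ) (p : Space n × ℝ) : ℝ :=
  heatKernel n (X.1 - p.1.1) (t - p.2)

/-- The formula for the kernel on `{τ < t}`, as a function of `(Y, τ)`. -/
def profile (a : ℝ) (X : Space n) (t : ℝ) (p : Space n × ℝ) : ℝ :=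
  heatFactor X t p * kernel1 a X.2 p.1.2 (t - p.2)

/-- The tangential part of the gradient of `profile`. -/
def profileGradFst (a : ℝ) (X : Space n) (t : ℝ) (p : Space n × ℝ) :
    EuclideanSpace ℝ (Fin (n - 1)) :=
  (profile a X t p / (2 * (t - p.2))) • (X.1 - p.1.1)

/-- The `y`-derivative of `profile`. -/
def profileGradSnd (a : ℝ) (X : Space n) (t : ℝ) (p : Space n × ℝ) : ℝ :=
  heatFactor X t p * (kernelDerivReg a X.2 p.1.2 (t - p.2) +
    |p.1.2| ^ (-a) * kernelDerivSing a X.2 p.1.2 (t - p.2))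

variable {X : Space n} {t : ℝ} {p : Space n × ℝ}

lemma isOpen_halfSpace (t : ℝ) : IsOpen (univ ×ˢ Iio t : Set (Space n × ℝ)) :=
  isOpen_univ.prod isOpen_Iio

lemma sub_pos_of_mem (hp : p ∈ (univ ×ˢ Iio t : Set (Space n × ℝ))) : 0 < t - p.2 :=
  sub_pos.2 hp.2

lemma Γ_eq_profile (hp : p ∈ (univ ×ˢ Iio t : Set (Space n × ℝ))) :
    DegenerateHeat.Γ n a X t p.1 p.2 = profile a X t p :=
  Γ_of_lt hp.2

lemma continuousOn_heatFactor (X : Space n) (t : ℝ) :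
    ContinuousOn (heatFactor X t) (univ ×ˢ Iio t) := by
  intro p hp
  have h1 : ContinuousAt (fun q : EuclideanSpace ℝ (Fin (n - 1)) × ℝ => heatKernel n q.1 q.2)
      ((fun p : Space n × ℝ => (X.1 - p.1.1, t - p.2)) p) :=
    (differentiableAt_heatKernel (sub_pos_of_mem hp)).continuousAt
  exact (ContinuousAt.comp (f := fun p : Space n × ℝ => (X.1 - p.1.1, t - p.2)) h1
    (by fun_prop)).continuousWithinAt

lemma continuousOn_comp_kernel {k : ℝ → ℝ → ℝ}
    (hk : ContinuousOn (fun q : ℝ × ℝ => k q.1 q.2) {q | 0 < q.2}) (t : ℝ) :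
    ContinuousOn (fun p : Space n × ℝ => k p.1.2 (t - p.2)) (univ ×ˢ Iio t) :=
  hk.comp (f := fun p : Space n × ℝ => (p.1.2, t - p.2)) (by fun_prop)
    fun _ hp => sub_pos_of_mem hp

lemma continuousOn_profile (ha : -1 < a) (ha' : a < 1) (X : Space n) (t : ℝ) :
    ContinuousOn (profile a X t) (univ ×ˢ Iio t) :=
  (continuousOn_heatFactor X t).mul (continuousOn_comp_kernel (continuousOn_kernel1 ha ha' X.2) t)

lemma continuousOn_div_time {f : Space n × ℝ → ℝ} (hf : ContinuousOn f (univ ×ˢ Iio t)) :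
    ContinuousOn (fun p => f p / (2 * (t - p.2))) (univ ×ˢ Iio t) :=
  hf.div (by fun_prop) fun p hp => by
    have := sub_pos_of_mem hp
    positivity

lemma continuousOn_profileGradFst (ha : -1 < a) (ha' : a < 1) (X : Space n) (t : ℝ) :
    ContinuousOn (profileGradFst a X t) (univ ×ˢ Iio t) :=
  (continuousOn_div_time (continuousOn_profile ha ha' X t)).smul (by fun_prop)

lemma hasGradientAt_profile (a : ℝ) (X : Space n) (t : ℝ) (p : Space n × ℝ) :
    HasGradientAt (fun v => profile a X t ((v, p.1.2), p.2)) (profileGradFst a X t p) p.1.1 := by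
  have h := hasGradientAt_heatKernel_sub (s := t - p.2) X.1 p.1.1
  rw [hasGradientAt_iff_hasFDerivAt] at h ⊢
  refine (h.mul_const (kernel1 a X.2 p.1.2 (t - p.2))).congr_fderiv ?_
  rw [← map_smul]
  congr 1
  rw [profileGradFst, profile, heatFactor, smul_smul]
  congr 1
  ring

lemma hasDerivAt_profile_snd (ha : -1 < a) (ha' : a < 1)
    (hp : p ∈ (univ ×ˢ Iio t : Set (Space n × ℝ))) (hy : p.1.2 ≠ 0) :
    HasDerivAt (fun y => profile a X t ((p.1.1, y), p.2)) (profileGradSnd a X t p) p.1.2 :=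
  (hasDerivAt_kernel1_space (x := X.2) ha ha' (sub_pos_of_mem hp) hy).const_mul
    (heatFactor X t p)

lemma spatialGrad_Γ_fst (hp : p ∈ (univ ×ˢ Iio t : Set (Space n × ℝ))) :
    (spatialGrad (fun p : Space n × ℝ => DegenerateHeat.Γ n a X t p.1 p.2) p).1 =
      profileGradFst a X t p := by
  have e : (fun v => DegenerateHeat.Γ n a X t (v, p.1.2) p.2) =
      fun v => profile a X t ((v, p.1.2), p.2) :=
    funext fun v => Γ_eq_profile (p := ((v, p.1.2), p.2)) ⟨mem_univ _, hp.2⟩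
  simp only [spatialGrad, e]
  exact (hasGradientAt_profile a X t p).gradient

lemma spatialGrad_Γ_snd (ha : -1 < a) (ha' : a < 1)
    (hp : p ∈ (univ ×ˢ Iio t : Set (Space n × ℝ))) (hy : p.1.2 ≠ 0) :
    (spatialGrad (fun p : Space n × ℝ => DegenerateHeat.Γ n a X t p.1 p.2) p).2 =
      profileGradSnd a X t p := by
  have e : (fun y => DegenerateHeat.Γ n a X t (p.1.1, y) p.2) =
      fun y => profile a X t ((p.1.1, y), p.2) :=
    funext fun y => Γ_eq_profile (p := ((p.1.1, y), p.2)) ⟨mem_univ _, hp.2⟩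
  simp only [spatialGrad, e]
  exact (hasDerivAt_profile_snd ha ha' hp hy).deriv

lemma differentiableAt_Γ (ha : -1 < a) (ha' : a < 1) (X : Space n) {t τ : ℝ} {Y : Space n}
    (hY : Y.2 ≠ 0) (hτ : τ < t) :
    DifferentiableAt ℝ (fun p : Space n × ℝ => DegenerateHeat.Γ n a X t p.1 p.2) (Y, τ) := by
  have h1 : DifferentiableAt ℝ (heatFactor X t) (Y, τ) := by
    have h := differentiableAt_heatKernel (n := n) (q := (X.1 - Y.1, t - τ)) (sub_pos.2 hτ)
    exact h.comp (f := fun p : Space n × ℝ => (X.1 - p.1.1, t - p.2)) (Y, τ) (by fun_prop)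
  have h2 : DifferentiableAt ℝ (fun p : Space n × ℝ => kernel1 a X.2 p.1.2 (t - p.2)) (Y, τ) := by
    have h := differentiableAt_kernel1 ha ha' X.2 (q := (Y.2, t - τ)) (sub_pos.2 hτ) hY
    exact h.comp (f := fun p : Space n × ℝ => (p.1.2, t - p.2)) (Y, τ) (by fun_prop)
  refine (h1.mul h2).congr_of_eventuallyEq ?_
  filter_upwards [(isOpen_halfSpace t).mem_nhds (show (Y, τ) ∈ _ from ⟨mem_univ _, hτ⟩)] with p hp
  exact Γ_eq_profile hp

/-- The y-component is identified only off y = 0, where the derivative is known to exist; the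
hyperplane is a null set. -/
lemma ae_spatialGrad_Γ (ha : -1 < a) (ha' : a < 1) (X : Space n) (t : ℝ) :
    ∀ᵐ p : Space n × ℝ, p ∈ (univ ×ˢ Iio t : Set (Space n × ℝ)) →
      spatialGrad (fun p : Space n × ℝ => DegenerateHeat.Γ n a X t p.1 p.2) p =
        (profileGradFst a X t p, profileGradSnd a X t p) := by
  filter_upwards [ae_ne_zero] with p hy hp
  exact Prod.ext (spatialGrad_Γ_fst hp) (spatialGrad_Γ_snd ha ha' hp hy)

/-- All integrability of the gradient comes from this splitting into a continuous field and |y|^(-a)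
times a continuous field. -/
lemma profileGrad_eq (p : Space n × ℝ) :
    (profileGradFst a X t p, profileGradSnd a X t p) =
      (profileGradFst a X t p, heatFactor X t p * kernelDerivReg a X.2 p.1.2 (t - p.2)) +
      |p.1.2| ^ (-a) • ((0 : EuclideanSpace ℝ (Fin (n - 1))),
        heatFactor X t p * kernelDerivSing a X.2 p.1.2 (t - p.2)) := by
  ext1
  · simp
  · simp [profileGradSnd]
    ring

lemma continuousOn_gradReg (ha : -1 < a) (ha' : a < 1) (X : Space n) (t : ℝ) :
    ContinuousOn (fun p : Space n × ℝ => (profileGradFst a X t p,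
      heatFactor X t p * kernelDerivReg a X.2 p.1.2 (t - p.2))) (univ ×ˢ Iio t) :=
  (continuousOn_profileGradFst ha ha' X t).prodMk ((continuousOn_heatFactor X t).mul
    (continuousOn_comp_kernel (continuousOn_kernelDerivReg ha ha' X.2) t))

lemma continuousOn_gradSing (ha' : a < 1) (X : Space n) (t : ℝ) :
    ContinuousOn (fun p : Space n × ℝ => ((0 : EuclideanSpace ℝ (Fin (n - 1))),
      heatFactor X t p * kernelDerivSing a X.2 p.1.2 (t - p.2))) (univ ×ˢ Iio t) :=
  continuousOn_const.prodMk ((continuousOn_heatFactor X t).mul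
    (continuousOn_comp_kernel (continuousOn_kernelDerivSing ha' X.2) t))

lemma locallyIntegrableOn_spatialGrad_Γ (ha : -1 < a) (ha' : a < 1) (X : Space n) (t : ℝ) :
    LocallyIntegrableOn (spatialGrad (fun p : Space n × ℝ => DegenerateHeat.Γ n a X t p.1 p.2))
      (univ ×ˢ Iio t) := by
  have hU := isOpen_halfSpace (n := n) t
  have h1 := (continuousOn_gradReg ha ha' X t).locallyIntegrableOn (μ := volume) hU.measurableSet
  have h2 := ((locallyIntegrable_abs_rpow (n := n) (α := -a)
    (by linarith)).locallyIntegrableOn (univ ×ˢ Iio t)).smul_continuousOn hU.isLocallyClosed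
    (continuousOn_gradSing ha' X t)
  refine LocallyIntegrableOn.congr ?_ (h1.add h2)
  filter_upwards [ae_restrict_of_ae (ae_spatialGrad_Γ ha ha' X t),
    ae_restrict_mem hU.measurableSet] with p hp hpU
  rw [hp hpU, profileGrad_eq]
  rfl

lemma integrable_smul_gradient (ha : -1 < a) (ha' : a < 1) (X : Space n) (t : ℝ)
    {ψ : Space n × ℝ → ℝ} (hψ : IsTest (univ ×ˢ Iio t) ψ) :
    Integrable fun p => ψ p • (profileGradFst a X t p, profileGradSnd a X t p) := by
  obtain ⟨h1, hc, hs⟩ := hψ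
  have hU := isOpen_halfSpace (n := n) t
  have i1 := integrable_of_continuousOn hU hc hs
    (h1.continuous.continuousOn.smul (continuousOn_gradReg ha ha' X t)) fun p hp => by
      rw [Pi.smul_apply', image_eq_zero_of_notMem_tsupport hp, zero_smul]
  have i2 := integrable_abs_rpow_smul (α := -a) (by linarith) hU hc hs
    (h1.continuous.continuousOn.smul (continuousOn_gradSing ha' X t)) fun p hp => by
      rw [Pi.smul_apply', image_eq_zero_of_notMem_tsupport hp, zero_smul]
  refine (i1.add i2).congr (Eventually.of_forall fun p => ?_)
  simp only [Pi.add_apply, Pi.smul_apply']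
  rw [profileGrad_eq, smul_add, smul_comm]

theorem isWeakSpatialGrad_Γ (ha : -1 < a) (ha' : a < 1) (X : Space n) (t : ℝ) :
    IsWeakSpatialGrad (univ ×ˢ Iio t) (fun p => DegenerateHeat.Γ n a X t p.1 p.2)
      (spatialGrad (fun p => DegenerateHeat.Γ n a X t p.1 p.2)) := by
  have hU := isOpen_halfSpace (n := n) t
  have hprof := continuousOn_profile ha ha' X t
  refine ⟨(hprof.congr fun p hp => Γ_eq_profile hp).locallyIntegrableOn hU.measurableSet,
    locallyIntegrableOn_spatialGrad_Γ ha ha' X t, fun ψ hψ => ?_⟩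
  obtain ⟨h1, hc, hs⟩ := hψ
  have hd := h1.differentiable one_ne_zero
  have hf := h1.continuous_fderiv one_ne_zero
  have hψ0 : ∀ p, p ∉ tsupport ψ → ψ p = 0 := fun p hp => image_eq_zero_of_notMem_tsupport hp
  have hg0 : ∀ p, p ∉ tsupport ψ → spatialGrad ψ p = 0 :=
    fun p hp => spatialGrad_eq_zero_of_notMem_tsupport hd hp
  have eL : ∫ p in univ ×ˢ Iio t, DegenerateHeat.Γ n a X t p.1 p.2 • spatialGrad ψ p =
      ∫ p, profile a X t p • spatialGrad ψ p :=
    (setIntegral_congr_fun hU.measurableSet fun p hp => by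
      simp only [Γ_eq_profile hp]).trans
    (setIntegral_eq_integral_of_forall_compl_eq_zero fun p hp => by
      rw [hg0 p fun h => hp (hs h), smul_zero])
  have eR : ∫ p in univ ×ˢ Iio t,
      ψ p • spatialGrad (fun p => DegenerateHeat.Γ n a X t p.1 p.2) p =
      ∫ p, ψ p • (profileGradFst a X t p, profileGradSnd a X t p) := by
    refine (setIntegral_congr_ae hU.measurableSet ?_).trans
      (setIntegral_eq_integral_of_forall_compl_eq_zero fun p hp => by
        rw [hψ0 p fun h => hp (hs h), zero_smul])
    filter_upwards [ae_spatialGrad_Γ ha ha' X t] with p hp hpU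
    rw [hp hpU]
  have iL : Integrable fun p => profile a X t p • spatialGrad ψ p :=
    integrable_of_continuousOn hU hc hs
      (hprof.smul (continuous_spatialGrad h1).continuousOn) fun p hp => by
        rw [hg0 p hp, smul_zero]
  have iR := integrable_smul_gradient ha ha' X t ⟨h1, hc, hs⟩
  have i0 : Integrable fun p => profile a X t p * ψ p :=
    integrable_of_continuousOn hU hc hs (hprof.mul h1.continuous.continuousOn) fun p hp => by
      rw [hψ0 p hp, mul_zero]
  rw [eL, eR]
  -- Tangentially the identity is tested against an arbitrary vector w, where the kernel is
  -- differentiable everywhere; the y-component uses continuity across y = 0.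
  ext1
  · refine ext_inner_left ℝ fun w => ?_
    set L : Space n →L[ℝ] ℝ := (innerSL ℝ w).comp
      (ContinuousLinearMap.fst ℝ (EuclideanSpace ℝ (Fin (n - 1))) ℝ) with hL
    have l1 := L.integral_comp_comm iL
    have l2 := L.integral_comp_comm iR
    have e1 : ∀ p, L (profile a X t p • spatialGrad ψ p) =
        profile a X t p * fderiv ℝ ψ p ((w, 0), 0) := fun p => by
      rw [map_smul, smul_eq_mul, ← inner_spatialGrad_fst hd]
      rfl
    have e2 : ∀ p, L (ψ p • (profileGradFst a X t p, profileGradSnd a X t p)) =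
        inner ℝ (profileGradFst a X t p) w * ψ p := fun p => by
      rw [map_smul, smul_eq_mul, real_inner_comm, mul_comm]
      rfl
    have i1 := L.integrable_comp iL
    have i2 := L.integrable_comp iR
    simp only [e1, e2] at l1 l2 i1 i2
    have key := integral_mul_fderiv_eq_neg (g := profile a X t)
      (g' := fun p => inner ℝ (profileGradFst a X t p) w) hd ((w, 0), 0)
      (fun p _ => by
        have := hasLineDerivAt_fst (hasGradientAt_profile a X t p).hasFDerivAt w
        simpa using this) i1 i2 i0
    rw [l1, l2] at key
    rw [Prod.fst_neg, inner_neg_right]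
    exact key
  · set L : Space n →L[ℝ] ℝ :=
      ContinuousLinearMap.snd ℝ (EuclideanSpace ℝ (Fin (n - 1))) ℝ with hL
    have l1 := L.integral_comp_comm iL
    have l2 := L.integral_comp_comm iR
    have e1 : ∀ p, L (profile a X t p • spatialGrad ψ p) =
        profile a X t p * fderiv ℝ ψ p ((0, 1), 0) := fun p => by
      rw [map_smul, smul_eq_mul, ← spatialGrad_snd hd]
      rfl
    have e2 : ∀ p, L (ψ p • (profileGradFst a X t p, profileGradSnd a X t p)) =
        profileGradSnd a X t p * ψ p := fun p => by
      rw [map_smul, smul_eq_mul, mul_comm]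
      rfl
    have i2 := L.integrable_comp iR
    simp only [e1, e2] at l1 l2 i2
    have key := (integral_mul_fderiv_snd_eq_neg hU ⟨h1, hc, hs⟩ hprof
      (fun p hp hy => hasDerivAt_profile_snd ha ha' hp hy) i2).2
    rw [l1, l2] at key
    rw [Prod.snd_neg]
    exact key

theorem memEnergyLoc_Γ (ha : -1 < a) (ha' : a < 1) (X : Space n) (t : ℝ) :
    MemEnergyLoc a (univ ×ˢ Iio t) (fun p => DegenerateHeat.Γ n a X t p.1 p.2)
      (spatialGrad (fun p => DegenerateHeat.Γ n a X t p.1 p.2)) := by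
  refine ⟨isWeakSpatialGrad_Γ ha ha' X t, fun K hK hKU => ?_⟩
  have hw : ∀ α : ℝ, -1 < α → ∀ c : Space n × ℝ → ℝ, ContinuousOn c (univ ×ˢ Iio t) →
      IntegrableOn (fun p => |p.1.2| ^ α * c p) K := fun α hα c hc =>
    ((locallyIntegrable_abs_rpow hα).integrableOn_isCompact hK).mul_continuousOn (hc.mono hKU) hK
  have hprof := continuousOn_profile ha ha' X t
  have hreg : ContinuousOn (fun p : Space n × ℝ =>
      heatFactor X t p * kernelDerivReg a X.2 p.1.2 (t - p.2)) (univ ×ˢ Iio t) :=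
    (continuousOn_gradReg ha ha' X t).snd
  have hsing : ContinuousOn (fun p : Space n × ℝ =>
      heatFactor X t p * kernelDerivSing a X.2 p.1.2 (t - p.2)) (univ ×ˢ Iio t) :=
    (continuousOn_gradSing ha' X t).snd
  constructor
  · refine (hw a ha _ (hprof.pow 2)).congr_fun (fun p hp => ?_) hK.measurableSet
    simp only [Γ_eq_profile (hKU hp), Pi.pow_apply]
  -- Squaring R + |y|^(-a) S and multiplying by |y|^a produces the three weights |y|^a, 1 and
  -- |y|^(-a), one for each integral.
  · have i1 := hw a ha _ (((continuousOn_profileGradFst ha ha' X t).norm.pow 2).add (hreg.pow 2))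
    have i2 := hw 0 (by norm_num) _ ((continuousOn_const (c := (2 : ℝ))).mul (hreg.mul hsing))
    have i3 := hw (-a) (by linarith) _ (hsing.pow 2)
    refine ((i1.add i2).add i3).congr_fun_ae ?_
    filter_upwards [ae_restrict_of_ae (ae_spatialGrad_Γ ha ha' X t), ae_restrict_of_ae ae_ne_zero,
      ae_restrict_mem hK.measurableSet] with p hp hy hpK
    have h0 : |p.1.2| ^ a * |p.1.2| ^ (-a) = 1 := by
      rw [← Real.rpow_add (abs_pos.2 hy), add_neg_cancel, Real.rpow_zero]
    rw [hp (hKU hpK)]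
    simp only [Pi.add_apply, Pi.pow_apply, Pi.mul_apply, dot, real_inner_self_eq_norm_sq,
      Real.rpow_zero, profileGradSnd]
    set R := kernelDerivReg a X.2 p.1.2 (t - p.2)
    set S := kernelDerivSing a X.2 p.1.2 (t - p.2)
    linear_combination (-(heatFactor X t p ^ 2 * (2 * R * S + |p.1.2| ^ (-a) * S ^ 2))) * h0

end

end DegenerateHeat

/-! ### The weak equation. -/

namespace DegenerateHeat

noncomputable section

variable {n : ℕ} {a : ℝ} {X : Space n} {t : ℝ} {p : Space n × ℝ}

/-- The time derivative of `profile`. -/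
def profileRate (a : ℝ) (X : Space n) (t : ℝ) (p : Space n × ℝ) : ℝ :=
  -(profile a X t p * (-((n : ℝ) - 1) / (2 * (t - p.2)) +
      ‖X.1 - p.1.1‖ ^ 2 / (4 * (t - p.2) ^ 2)) +
    heatFactor X t p * kernelRate a X.2 p.1.2 (t - p.2))

/-- The second derivative of `profile` in the `i`-th tangential direction. -/
def profileSecond (a : ℝ) (X : Space n) (t : ℝ) (i : Fin (n - 1)) (p : Space n × ℝ) : ℝ :=
  profile a X t p * ((X.1 - p.1.1) i ^ 2 / (4 * (t - p.2) ^ 2) - 1 / (2 * (t - p.2)))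

/-- The flux `|y| ^ a ∂_y profile`. -/
def profileFlux (a : ℝ) (X : Space n) (t : ℝ) (p : Space n × ℝ) : ℝ :=
  heatFactor X t p * kernelFlux a X.2 p.1.2 (t - p.2)

lemma continuousOn_profileRate (ha : -1 < a) (ha' : a < 1) (X : Space n) (t : ℝ) :
    ContinuousOn (profileRate a X t) (univ ×ˢ Iio t) := by
  refine (((continuousOn_profile ha ha' X t).mul (ContinuousOn.add ?_ ?_)).add
    ((continuousOn_heatFactor X t).mul
      (continuousOn_comp_kernel (continuousOn_kernelRate ha ha' X.2) t))).neg
  · exact continuousOn_div_time continuousOn_const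
  · refine ContinuousOn.div (by fun_prop) (by fun_prop) fun p hp => ?_
    have := sub_pos_of_mem hp
    positivity

lemma continuousOn_profileSecond (ha : -1 < a) (ha' : a < 1) (X : Space n) (t : ℝ)
    (i : Fin (n - 1)) : ContinuousOn (profileSecond a X t i) (univ ×ˢ Iio t) := by
  refine (continuousOn_profile ha ha' X t).mul (ContinuousOn.sub ?_ ?_)
  · refine ContinuousOn.div (by fun_prop) (by fun_prop) fun p hp => ?_
    have := sub_pos_of_mem hp
    positivity
  · exact continuousOn_div_time continuousOn_const

lemma continuousOn_profileFlux (ha : -1 < a) (ha' : a < 1) (X : Space n) (t : ℝ) :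
    ContinuousOn (profileFlux a X t) (univ ×ˢ Iio t) :=
  (continuousOn_heatFactor X t).mul
    (continuousOn_comp_kernel (continuousOn_kernelFlux ha ha' X.2) t)

lemma hasDerivAt_profile_time (ha : -1 < a) (ha' : a < 1)
    (hp : p ∈ (univ ×ˢ Iio t : Set (Space n × ℝ))) :
    HasDerivAt (fun τ => profile a X t (p.1, τ)) (profileRate a X t p) p.2 := by
  have hs := sub_pos_of_mem hp
  have h1 := (hasDerivAt_heatKernel_time (X.1 - p.1.1) hs).comp_const_sub t p.2
  have h2 := (hasDerivAt_kernel1_time (x := X.2) (y := p.1.2) ha ha' hs).comp_const_sub t p.2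
  refine (h1.mul h2).congr_deriv ?_
  rw [profileRate, profile, heatFactor]
  ring

lemma hasLineDerivAt_profileGradFst (hp : p ∈ (univ ×ˢ Iio t : Set (Space n × ℝ)))
    (i : Fin (n - 1)) :
    HasLineDerivAt ℝ (fun p => profileGradFst a X t p i) (profileSecond a X t i p) p
      ((EuclideanSpace.single i 1, 0), 0) := by
  have hs := sub_pos_of_mem hp
  have h1 := (hasGradientAt_profile a X t p).hasFDerivAt
  have h2 : HasFDerivAt (fun v : EuclideanSpace ℝ (Fin (n - 1)) => (X.1 - v) i)
      (-(EuclideanSpace.proj i : EuclideanSpace ℝ (Fin (n - 1)) →L[ℝ] ℝ)) p.1.1 := by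
    simpa using (EuclideanSpace.proj (𝕜 := ℝ) i).hasFDerivAt.const_sub (X.1 i) (x := p.1.1)
  have h3 := (h1.mul_const (2 * (t - p.2))⁻¹).mul h2
  have h4 := hasLineDerivAt_fst (g := fun p => profileGradFst a X t p i) (p := p) h3
    (EuclideanSpace.single i 1)
  refine HasDerivAt.congr_deriv h4 ?_
  simp [profileSecond, profileGradFst, EuclideanSpace.inner_single_right]
  field_simp
  ring

lemma hasDerivAt_profileFlux (ha : -1 < a) (ha' : a < 1)
    (hp : p ∈ (univ ×ˢ Iio t : Set (Space n × ℝ))) (hy : p.1.2 ≠ 0) :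
    HasDerivAt (fun y => profileFlux a X t ((p.1.1, y), p.2))
      (|p.1.2| ^ a * (heatFactor X t p * kernelRate a X.2 p.1.2 (t - p.2))) p.1.2 := by
  refine ((hasDerivAt_kernelFlux (x := X.2) ha ha' (sub_pos_of_mem hp) hy).const_mul
    (heatFactor X t p)).congr_deriv ?_
  ring

/-- The profile solves the backward equation off `y = 0`. -/
lemma profile_equation (hn : 1 ≤ n) (hp : p ∈ (univ ×ˢ Iio t : Set (Space n × ℝ))) :
    profileRate a X t p + ∑ i, profileSecond a X t i p +
      heatFactor X t p * kernelRate a X.2 p.1.2 (t - p.2) = 0 := by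
  have hs := sub_pos_of_mem hp
  have h1 : ∑ i, profileSecond a X t i p = profile a X t p *
      (‖X.1 - p.1.1‖ ^ 2 / (4 * (t - p.2) ^ 2) - ((n : ℝ) - 1) / (2 * (t - p.2))) := by
    simp only [profileSecond]
    rw [← Finset.mul_sum, Finset.sum_sub_distrib, ← Finset.sum_div, EuclideanSpace.real_norm_sq_eq,
      Finset.sum_const, Finset.card_univ, Fintype.card_fin, nsmul_eq_mul, Nat.cast_sub hn,
      Nat.cast_one, mul_one_div]
  rw [h1, profileRate]
  ring

/-- The integrand becomes a sum of scalar products with directional derivatives of φ, ready for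
integration by parts one direction at a time; the y-term contains the weight only through the flux.
-/
lemma weak_integrand_eq (ha : -1 < a) (ha' : a < 1) {φ : Space n × ℝ → ℝ}
    (hφ : Differentiable ℝ φ) (hp : p ∈ (univ ×ˢ Iio t : Set (Space n × ℝ))) (hy : p.1.2 ≠ 0) :
    |p.1.2| ^ a * (DegenerateHeat.Γ n a X t p.1 p.2 * timeDeriv φ p +
      dot (spatialGrad (fun p => DegenerateHeat.Γ n a X t p.1 p.2) p) (spatialGrad φ p)) =
    |p.1.2| ^ a * profile a X t p * fderiv ℝ φ p (0, 1) +
      ∑ i, |p.1.2| ^ a * profileGradFst a X t p i *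
        fderiv ℝ φ p ((EuclideanSpace.single i 1, 0), 0) +
      profileFlux a X t p * fderiv ℝ φ p ((0, 1), 0) := by
  have h1 : inner ℝ (profileGradFst a X t p) (spatialGrad φ p).1 =
      ∑ i, profileGradFst a X t p i * fderiv ℝ φ p ((EuclideanSpace.single i 1, 0), 0) := by
    rw [PiLp.inner_apply]
    refine Finset.sum_congr rfl fun i _ => ?_
    rw [← inner_spatialGrad_fst hφ, EuclideanSpace.inner_single_left]
    simp [mul_comm]
  have h2 : |p.1.2| ^ a * profileGradSnd a X t p = profileFlux a X t p := by
    rw [profileGradSnd, profileFlux, ← rpow_mul_kernelDeriv hy]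
    ring
  rw [dot, spatialGrad_Γ_fst hp, spatialGrad_Γ_snd ha ha' hp hy, Γ_eq_profile hp, timeDeriv_eq hφ,
    h1, spatialGrad_snd hφ, ← h2]
  simp only [mul_assoc, ← Finset.mul_sum]
  ring

theorem isWeakSolution_Γ (hn : 1 ≤ n) (ha : -1 < a) (ha' : a < 1) (X : Space n) (t : ℝ) :
    IsWeakSolution a (univ ×ˢ Iio t) (fun p => DegenerateHeat.Γ n a X t p.1 p.2)
      (spatialGrad (fun p => DegenerateHeat.Γ n a X t p.1 p.2)) := by
  refine ⟨memEnergyLoc_Γ ha ha' X t, fun φ hφ => ?_⟩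
  have hU := isOpen_halfSpace (n := n) t
  obtain ⟨hφ1, hc, hs⟩ := hφ
  have hd := hφ1.differentiable one_ne_zero
  have hf := hφ1.continuous_fderiv one_ne_zero
  have hφ0 : ∀ p, p ∉ tsupport φ → φ p = 0 := fun p hp => image_eq_zero_of_notMem_tsupport hp
  have hf0 : ∀ p, p ∉ tsupport φ → fderiv ℝ φ p = 0 :=
    fun p hp => fderiv_eq_zero_of_notMem_tsupport hp
  have hprof := continuousOn_profile ha ha' X t
  have hgrad : ∀ i, ContinuousOn (fun p => profileGradFst a X t p i) (univ ×ˢ Iio t) := fun i =>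
    (EuclideanSpace.proj (𝕜 := ℝ) i).continuous.comp_continuousOn
      (continuousOn_profileGradFst ha ha' X t)
  have hsec := continuousOn_profileSecond ha ha' X t
  have hrate := continuousOn_profileRate ha ha' X t
  have hlast : ContinuousOn (fun p : Space n × ℝ =>
      heatFactor X t p * kernelRate a X.2 p.1.2 (t - p.2)) (univ ×ˢ Iio t) :=
    (continuousOn_heatFactor X t).mul
      (continuousOn_comp_kernel (continuousOn_kernelRate ha ha' X.2) t)
  have J : ∀ c : Space n × ℝ → ℝ, ContinuousOn c (univ ×ˢ Iio t) →
      Integrable fun p => |p.1.2| ^ a * c p * φ p := fun c hc' =>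
    (integrable_abs_rpow_smul ha hU hc hs (hc'.mul hφ1.continuous.continuousOn) fun p hp => by
      rw [Pi.mul_apply, hφ0 p hp, mul_zero]).congr (Eventually.of_forall fun p => by
        simp only [smul_eq_mul, Pi.mul_apply]; ring)
  have J' : ∀ c : Space n × ℝ → ℝ, ContinuousOn c (univ ×ˢ Iio t) → ∀ v,
      Integrable fun p => |p.1.2| ^ a * c p * fderiv ℝ φ p v := fun c hc' v =>
    (integrable_abs_rpow_smul ha hU hc hs
      (hc'.mul (hf.clm_apply (continuous_const (y := v))).continuousOn) fun p hp => by
      rw [Pi.mul_apply, hf0 p hp, zero_apply, mul_zero]).congr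
        (Eventually.of_forall fun p => by simp only [smul_eq_mul, Pi.mul_apply]; ring)
  -- In the time direction, and in the tangential directions of `ki`, the weight |y|^a is constant,
  -- so its singularity is harmless.
  have kt := integral_mul_fderiv_eq_neg (g := fun p => |p.1.2| ^ a * profile a X t p)
    (g' := fun p => |p.1.2| ^ a * profileRate a X t p) hd (0, 1)
    (fun p hp => hasLineDerivAt_time
      ((hasDerivAt_profile_time (X := X) ha ha' (hs hp)).const_mul (|p.1.2| ^ a)))
    (J' _ hprof _) (J _ hrate) (J _ hprof)
  have ki := fun i => integral_mul_fderiv_eq_neg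
    (g := fun p => |p.1.2| ^ a * profileGradFst a X t p i)
    (g' := fun p => |p.1.2| ^ a * profileSecond a X t i p) hd ((EuclideanSpace.single i 1, 0), 0)
    (fun p hp => by
      have h := hasLineDerivAt_profileGradFst (a := a) (X := X) (hs hp) i
      have h' := HasDerivAt.const_mul (|p.1.2| ^ a) h
      refine HasDerivAt.congr_of_eventuallyEq h' (Eventually.of_forall fun r => ?_)
      simp)
    (J' _ (hgrad i) _) (J _ (hsec i)) (J _ (hgrad i))
  have ky := integral_mul_fderiv_snd_eq_neg hU ⟨hφ1, hc, hs⟩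
    (continuousOn_profileFlux ha ha' X t)
    (fun p hp hy => hasDerivAt_profileFlux ha ha' hp hy) (J _ hlast)
  have iS : Integrable fun p => ∑ i, |p.1.2| ^ a * profileGradFst a X t p i *
      fderiv ℝ φ p ((EuclideanSpace.single i 1, 0), 0) :=
    integrable_finsetSum _ fun i _ => J' _ (hgrad i) _
  have iAll := ((J' _ hprof (0, 1)).add iS).add ky.1
  have eAll : (fun p => |p.1.2| ^ a * profile a X t p * fderiv ℝ φ p (0, 1) +
      ∑ i, |p.1.2| ^ a * profileGradFst a X t p i *
        fderiv ℝ φ p ((EuclideanSpace.single i 1, 0), 0) +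
      profileFlux a X t p * fderiv ℝ φ p ((0, 1), 0)) =ᵐ[volume.restrict (univ ×ˢ Iio t)]
      fun p => |p.1.2| ^ a * (DegenerateHeat.Γ n a X t p.1 p.2 * timeDeriv φ p +
        dot (spatialGrad (fun p => DegenerateHeat.Γ n a X t p.1 p.2) p) (spatialGrad φ p)) := by
    filter_upwards [ae_restrict_of_ae ae_ne_zero, ae_restrict_mem hU.measurableSet] with p hy hp
    exact (weak_integrand_eq ha ha' hd hp hy).symm
  refine ⟨iAll.integrableOn.congr_fun_ae eAll, ?_⟩
  rw [← integral_congr_ae eAll, setIntegral_eq_integral_of_forall_compl_eq_zero fun p hp => by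
    simp [hf0 p fun h => hp (hs h)]]
  have e1 := integral_add ((J' _ hprof (0, 1)).add iS) ky.1
  have e2 := integral_add (J' _ hprof (0, 1)) iS
  have e3 := integral_finsetSum Finset.univ
    fun i (_ : i ∈ Finset.univ) => J' _ (hgrad i) ((EuclideanSpace.single i 1, 0), 0)
  simp only [Pi.add_apply] at e1
  rw [e1, e2, e3, kt, ky.2, Finset.sum_congr rfl fun i _ => ki i, Finset.sum_neg_distrib,
    ← integral_finsetSum _ fun i _ => J _ (hsec i)]
  have iS' : Integrable fun p => ∑ i, |p.1.2| ^ a * profileSecond a X t i p * φ p :=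
    integrable_finsetSum _ fun i _ => J _ (hsec i)
  -- Up to sign this is the result of all the integrations by parts; it is |y|^a φ times the
  -- pointwise equation.
  have hz : ∫ p, (|p.1.2| ^ a * profileRate a X t p * φ p +
      ∑ i, |p.1.2| ^ a * profileSecond a X t i p * φ p +
      |p.1.2| ^ a * (heatFactor X t p * kernelRate a X.2 p.1.2 (t - p.2)) * φ p) = 0 := by
    refine integral_eq_zero_of_ae (Eventually.of_forall fun p => ?_)
    by_cases hp : p ∈ tsupport φ
    · have h := profile_equation (a := a) (X := X) hn (hs hp)
      simp only [Pi.zero_apply, ← Finset.sum_mul, ← Finset.mul_sum]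
      linear_combination |p.1.2| ^ a * φ p * h
    · simp [hφ0 p hp]
  have e4 := integral_add ((J _ hrate).add iS') (J _ hlast)
  have e5 := integral_add (J _ hrate) iS'
  simp only [Pi.add_apply] at e4
  rw [e4, e5] at hz
  linarith

end

end DegenerateHeat

theorem theorem2p1 (n : ℕ) (hn : 2 ≤ n) (a : ℝ) (ha : -1 < a) (ha' : a < 1) :
    (∀ (X : Space n) (t : ℝ),
      (∀ (Y : Space n) (τ : ℝ), Y.2 ≠ 0 → τ < t →
        DifferentiableAt ℝ (fun p : Space n × ℝ => DegenerateHeat.Γ n a X t p.1 p.2) (Y, τ)) ∧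
      IsWeakSolution a (univ ×ˢ Iio t)
        (fun p => DegenerateHeat.Γ n a X t p.1 p.2)
        (spatialGrad (fun p => DegenerateHeat.Γ n a X t p.1 p.2))) ∧
    (∀ g : Space n → ℝ, Continuous g → (∃ M : ℝ, ∀ Y, |g Y| ≤ M) →
      ∀ (X : Space n) (τ : ℝ),
        (∀ t, τ < t → Integrable (fun Y : Space n => DegenerateHeat.Γ n a X t Y τ * g Y * |Y.2| ^ a)) ∧
        Tendsto (fun t => ∫ Y : Space n, DegenerateHeat.Γ n a X t Y τ * g Y * |Y.2| ^ a)
          (𝓝[>] τ) (𝓝 (g X))) :=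
  ⟨fun X t => ⟨fun _ _ hY hτ => differentiableAt_Γ ha ha' X hY hτ,
      isWeakSolution_Γ (by omega) ha ha' X t⟩,
    fun _ hg ⟨_, hM⟩ X τ => Γ_initial_trace (by omega) ha ha' hg hM X τ⟩
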